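/- Let $\mu,\nu$ be finite Borel measures on $\mathbb{R}$ with finite first moment that are in convex-decreasing order, $\mu\leq_{cd}\nu$; that is, $\int\phi\,d\mu\leq\int\phi\,d\nu$ (in $(-\infty,\infty]$) for every convex, nonincreasing function $\phi:\mathbb{R}\to\mathbb{R}$. For finite measures $\mu',\nu'$ on $\mathbb{R}$ with finite first moment, the shadow $S^{\nu'}(\mu')$ of $\mu'$ in $\nu'$ is the unique least element, for the order $\leq_{cd}$, of the set of all finite measures $\theta$ on $\mathbb{R}$ with finite first moment such that $\mu'\leq_{cd}\theta\leq\nu'$ (the second inequality being setwise), whenever it exists. For every $x\in\mathbb{R}$, the shadows $S^{\nu}(\mu|_{(-\infty,x]})$ and $S^{\nu}(\mu|_{[x,\infty)})$ exist and are unique. Moreover: (i) There exists a unique measure $\overrightarrow{P}$ on $\mathbb{R}\times\mathbb{R}$ which transports $\mu|_{(-\infty,x]}$ to its shadow $S^{\nu}(\mu|_{(-\infty,x]})$ for all $x\in\mathbb{R}$; that is, the first marginal of $\overrightarrow{P}$ equals $\mu$ and $$\overrightarrow{P}((-\infty,x]\times A)=S^{\nu}(\mu|_{(-\infty,x]})(A)\quad\text{for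 all } x\in\mathbb{R} \text{ and all Borel sets } A\subseteq\mathbb{R}.$$ (ii) There exists a unique measure $\overleftarrow{P}$ on $\mathbb{R}\times\mathbb{R}$ which transports $\mu|_{[x,\infty)}$ to its shadow $S^{\nu}(\mu|_{[x,\infty)})$ for all $x\in\mathbb{R}$; that is, the first marginal of $\overleftarrow{P}$ equals $\mu$ and $$\overleftarrow{P}([x,\infty)\times A)=S^{\nu}(\mu|_{[x,\infty)})(A)\quad\text{for all } x\in\mathbb{R} \text{ and all Borel sets } A\subseteq\mathbb{R}.$$ (iii) Both $\overrightarrow{P}$ and $\overleftarrow{P}$ belong to the set $\mathcal{S}(\mu,\nu)$ of supermartingale couplings of $\mu$ and $\nu$, i.e., the measures $P$ on $\mathbb{R}\times\mathbb{R}$ with first marginal $\mu$ and second marginal $\nu$ such that $\int y\,\mathbf{1}_{B}(x)\,P(dx,dy)\leq\int x\,\mathbf{1}_{B}(x)\,P(dx,dy)$ for every Borel set $B\subseteq\mathbb{R}$. The measures $\overrightarrow{P}$ and $\overleftarrow{P}$ are called the Increasing and the Decreasing Supermartingale Transport, respectively. -/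

import Mathlib

open MeasureTheory Set

/-- Finite measures on the real line (with its Borel sigma-algebra) that have a finite first
moment. -/
structure FiniteFirstMoment (μ : Measure ℝ) : Prop where
  isFinite : IsFiniteMeasure μ
  integrable : Integrable (fun x : ℝ => x) μ

/-- The convex-decreasing order `μ ≤_cd ν` between finite measures with finite first moment:
`μ(φ) ≤ ν(φ)` for every convex nonincreasing `φ : ℝ → ℝ`.

A convex function is bounded below by an affine one, so for these measures `μ(φ)` and `ν(φ)` are
well defined in `(-∞, ∞]` and equal `∞` exactly when `φ` is not integrable. The inequality in
`(-∞, ∞]` therefore reads: if `ν(φ) < ∞`, then `μ(φ) < ∞` and the real integrals are ordered. -/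
structure ConvexDecreasingLE (μ ν : Measure ℝ) : Prop where
  left : FiniteFirstMoment μ
  right : FiniteFirstMoment ν
  integral_le : ∀ φ : ℝ → ℝ, ConvexOn ℝ univ φ → Antitone φ → Integrable φ ν →
    Integrable φ μ ∧ ∫ x, φ x ∂μ ≤ ∫ x, φ x ∂ν

/-- The set of all measures `θ` with finite first moment such that `μ ≤_cd θ ≤ ν`, where the second
inequality is the setwise order of measures. -/
def intermediateMeasures (μ ν : Measure ℝ) : Set (Measure ℝ) :=
  {θ | FiniteFirstMoment θ ∧ ConvexDecreasingLE μ θ ∧ θ ≤ ν}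

/-- `σ` is a least element, for the convex-decreasing order, of the set of all `θ` with
`μ ≤_cd θ ≤ ν`. -/
structure IsShadow (μ ν σ : Measure ℝ) : Prop where
  mem : σ ∈ intermediateMeasures μ ν
  least : ∀ θ ∈ intermediateMeasures μ ν, ConvexDecreasingLE σ θ

open Classical in
/-- The shadow `S^ν(μ)` of `μ` in `ν`: the least element, for the convex-decreasing order, of the
set of all `θ` with `μ ≤_cd θ ≤ ν` (and the zero measure if there is no least element). -/
noncomputable def shadow (μ ν : Measure ℝ) : Measure ℝ :=
  if h : ∃ σ, IsShadow μ ν σ then h.choose else 0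

/-- `P` has first marginal `μ` and sends `μ|_(-∞,x]` to its shadow in `ν`, for every real `x`. -/
structure IsIncreasingTransport (μ ν : Measure ℝ) (P : Measure (ℝ × ℝ)) : Prop where
  fst_eq : P.fst = μ
  apply_prod : ∀ x : ℝ, ∀ A : Set ℝ, MeasurableSet A →
    P (Iic x ×ˢ A) = shadow (μ.restrict (Iic x)) ν A

/-- `P` has first marginal `μ` and sends `μ|_[x,∞)` to its shadow in `ν`, for every real `x`. -/
structure IsDecreasingTransport (μ ν : Measure ℝ) (P : Measure (ℝ × ℝ)) : Prop where
  fst_eq : P.fst = μ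
  apply_prod : ∀ x : ℝ, ∀ A : Set ℝ, MeasurableSet A →
    P (Ici x ×ˢ A) = shadow (μ.restrict (Ici x)) ν A

/-- The set `𝒮(μ, ν)` of supermartingale couplings of two finite measures with finite first moment:
measures `P` on `ℝ × ℝ` with marginals `μ` and `ν` such that
`∫ Y 1_A(X) dP ≤ ∫ X 1_A(X) dP` for all Borel sets `A`, where `(X, Y)` is the identity. -/
def supermartingaleCouplings (μ ν : Measure ℝ) : Set (Measure (ℝ × ℝ)) :=
  {P | P.fst = μ ∧ P.snd = ν ∧ ∀ A : Set ℝ, MeasurableSet A →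
    ∫ p in Prod.fst ⁻¹' A, p.2 ∂P ≤ ∫ p in Prod.fst ⁻¹' A, p.1 ∂P}

/-!
Everything is read off the put potentials `put m k = ∫ (k - x)⁺ dm(x)`. A measure with finite first
moment is determined by its potential (`eq_of_put_eq`), the potentials are the convex functions that
vanish at `-∞` (`exists_putPotential_eq`) with the right behaviour at `∞`, and `μ ≤_cd ν` means equal
mass and `put μ ≤ put ν` (`convexDecreasingLE_of_put_le`). The last fact holds because a convex
nonincreasing function that is constant far to the right is, up to that constant, a mixture of put
payoffs.

If `θ ≤ ν` and `μ ≤_cd θ`, then `put ν - put θ = put (ν - θ)` is a convex minorant of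
`put ν - put μ`. The shadow of `μ` is therefore the measure with potential `put ν - D`, where `D` is
the greatest convex minorant of `put ν - put μ`. This function is a potential because `g - D` is
again convex when `D` is the greatest convex minorant of a difference `g - f` of convex functions
(`convexOn_sub_greatest_convex_minorant`), and its complement `ν - σ` has potential `D`. When
`μ + ρ ≤_cd ν`, the potential of `ρ` is a convex minorant, which forces the masses to be right
(`exists_isPutShadow`) and leaves room for `ρ` in `ν - σ`. Taking greatest convex minorants in two
stages shows that the shadow of `μ₁ + μ₂` in `ν` is `σ + τ`, where `σ` is the shadow of `μ₁` in `ν`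
and `τ` that of `μ₂` in `ν - σ` (`exists_isShadow_add`).

So the shadows of `μ` restricted to a growing family of half-lines grow, stay below `ν`, and have the
masses of the half-lines. Such a family is the distribution function, in its first coordinate, of
exactly one measure on the plane (`exists_measure_Iic_prod`, `ext_of_Iic_prod`). Over an interval of
starting points that measure has as second marginal an increment of the shadow, which dominates the
starting mass in the convex-decreasing order and hence has a smaller barycentre; intervals suffice
to conclude the supermartingale property (`setIntegral_preimage_nonneg`). The increasing and the
decreasing transport are treated together, as transports along the half-lines `{e ≤ x}` for `e` the
identity and the negation (`IsTransportAlong`).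
-/

open Filter Topology
open scoped ENNReal

/-! ### Put potentials -/

namespace FiniteFirstMoment

lemma mono {θ ν : Measure ℝ} (hν : FiniteFirstMoment ν) (h : θ ≤ ν) : FiniteFirstMoment θ := by
  have := hν.isFinite
  exact ⟨isFiniteMeasure_of_le ν h, hν.integrable.mono_measure h⟩

lemma add {θ ν : Measure ℝ} (hθ : FiniteFirstMoment θ) (hν : FiniteFirstMoment ν) :
    FiniteFirstMoment (θ + ν) := by
  have := hν.isFinite
  have := hθ.isFinite
  exact ⟨inferInstance, hθ.integrable.add_measure hν.integrable⟩

lemma of_add_left {θ ν : Measure ℝ} (h : FiniteFirstMoment (θ + ν)) : FiniteFirstMoment θ :=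
  h.mono (Measure.le_add_right le_rfl)

lemma of_add_right {θ ν : Measure ℝ} (h : FiniteFirstMoment (θ + ν)) : FiniteFirstMoment ν :=
  h.mono (Measure.le_add_left le_rfl)

lemma integrable_put {m : Measure ℝ} (hm : FiniteFirstMoment m) (k : ℝ) :
    Integrable (fun x => max (k - x) 0) m := by
  have := hm.isFinite
  exact ((integrable_const k).sub hm.integrable).pos_part

end FiniteFirstMoment

/-- The put potential of a measure on the line, `k ↦ ∫ (k - x)⁺ dm(x)`, with values in `[0, ∞]`. -/
noncomputable def putPotential (m : Measure ℝ) (k : ℝ) : ℝ≥0∞ := ∫⁻ x, ENNReal.ofReal (k - x) ∂m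

/-- The real-valued put potential, meaningful for measures with finite first moment. -/
noncomputable def put (m : Measure ℝ) (k : ℝ) : ℝ := ∫ x, max (k - x) 0 ∂m

lemma put_nonneg (m : Measure ℝ) (k : ℝ) : 0 ≤ put m k :=
  integral_nonneg fun _ => le_max_right _ _

lemma ofReal_put {m : Measure ℝ} (hm : FiniteFirstMoment m) (k : ℝ) :
    ENNReal.ofReal (put m k) = putPotential m k := by
  rw [put, ofReal_integral_eq_lintegral_ofReal (hm.integrable_put k)
    (ae_of_all _ fun _ => le_max_right _ _), putPotential]
  refine lintegral_congr fun x => ?_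
  rw [ENNReal.ofReal_max, ENNReal.ofReal_zero, max_eq_left zero_le]

lemma putPotential_ne_top {m : Measure ℝ} (hm : FiniteFirstMoment m) (k : ℝ) :
    putPotential m k ≠ ∞ := by
  rw [← ofReal_put hm]; exact ENNReal.ofReal_ne_top

lemma put_add {m n : Measure ℝ} (hm : FiniteFirstMoment m) (hn : FiniteFirstMoment n) (k : ℝ) :
    put (m + n) k = put m k + put n k :=
  integral_add_measure (hm.integrable_put k) (hn.integrable_put k)

lemma putPotential_add (m n : Measure ℝ) (k : ℝ) :
    putPotential (m + n) k = putPotential m k + putPotential n k :=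
  lintegral_add_measure _ _ _

/-- The right difference quotients of the put potential at `a` are at least the mass of
`(-∞, a]`. -/
lemma putPotential_add_le (m : Measure ℝ) {a b : ℝ} (hab : a ≤ b) :
    putPotential m a + ENNReal.ofReal (b - a) * m (Iic a) ≤ putPotential m b := by
  rw [putPotential, ← lintegral_indicator_const measurableSet_Iic,
    ← lintegral_add_left (by fun_prop)]
  refine lintegral_mono fun x => ?_
  by_cases hx : x ∈ Iic a
  · rw [indicator_of_mem hx, ← ENNReal.ofReal_add (sub_nonneg.2 hx) (sub_nonneg.2 hab)]
    simp
  · rw [indicator_of_notMem hx, add_zero]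
    exact ENNReal.ofReal_le_ofReal (by linarith)

/-- The left difference quotients of the put potential at `b` are at most the mass of `(-∞, b]`. -/
lemma putPotential_le_add (m : Measure ℝ) (a b : ℝ) :
    putPotential m b ≤ putPotential m a + ENNReal.ofReal (b - a) * m (Iic b) := by
  rw [putPotential, putPotential, ← lintegral_indicator_const measurableSet_Iic,
    ← lintegral_add_left (by fun_prop)]
  refine lintegral_mono fun x => ?_
  by_cases hx : x ∈ Iic b
  · rw [indicator_of_mem hx]
    refine le_trans (ENNReal.ofReal_le_ofReal ?_) ENNReal.ofReal_add_le
    linarith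
  · rw [ENNReal.ofReal_of_nonpos (by simp at hx; linarith)]
    exact zero_le

/-- The bounds on the difference quotients of the put potential, in real terms. -/
lemma toReal_putPotential_slope_bounds {m : Measure ℝ} {x y gx gy : ℝ} (hxy : x ≤ y)
    (hUx : putPotential m x ≠ ∞) (hUy : putPotential m y ≠ ∞) (hx : m (Iic x) = ENNReal.ofReal gx)
    (hy : m (Iic y) = ENNReal.ofReal gy) (hgx : 0 ≤ gx) (hgy : 0 ≤ gy) :
    (y - x) * gx ≤ (putPotential m y).toReal - (putPotential m x).toReal ∧
      (putPotential m y).toReal - (putPotential m x).toReal ≤ (y - x) * gy := by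
  have h1 := putPotential_add_le m hxy
  have h2 := putPotential_le_add m x y
  have hx' := mul_nonneg (sub_nonneg.2 hxy) hgx
  have hy' := mul_nonneg (sub_nonneg.2 hxy) hgy
  rw [hx, ← ENNReal.ofReal_mul (sub_nonneg.2 hxy), ← ENNReal.ofReal_toReal hUx,
    ← ENNReal.ofReal_toReal hUy, ← ENNReal.ofReal_add ENNReal.toReal_nonneg hx',
    ENNReal.ofReal_le_ofReal_iff ENNReal.toReal_nonneg] at h1
  rw [hy, ← ENNReal.ofReal_mul (sub_nonneg.2 hxy), ← ENNReal.ofReal_toReal hUx,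
    ← ENNReal.ofReal_toReal hUy, ← ENNReal.ofReal_add ENNReal.toReal_nonneg hy',
    ENNReal.ofReal_le_ofReal_iff (add_nonneg ENNReal.toReal_nonneg hy')] at h2
  constructor <;> linarith

lemma measure_Iic_ne_top {m : Measure ℝ} (hm : ∀ k, putPotential m k ≠ ∞) (k : ℝ) :
    m (Iic k) ≠ ∞ := by
  have h := putPotential_add_le m (show k ≤ k + 1 by linarith)
  rw [add_sub_cancel_left, ENNReal.ofReal_one, one_mul] at h
  exact ne_top_of_le_ne_top (hm (k + 1)) (le_trans le_add_self h)

lemma tendsto_measure_Iic_add_one_div {n : Measure ℝ} (hn : ∀ k, n (Iic k) ≠ ∞) (k : ℝ) :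
    Tendsto (fun j : ℕ => n (Iic (k + 1 / ((j : ℝ) + 1)))) atTop (𝓝 (n (Iic k))) := by
  have hInter : (⋂ j : ℕ, Iic (k + 1 / ((j : ℝ) + 1))) = Iic k := by
    ext x
    simp only [mem_iInter, mem_Iic]
    refine ⟨fun hx => ?_, fun hx j => hx.trans ?_⟩
    · refine ge_of_tendsto' (x := atTop) (f := fun j : ℕ => k + 1 / ((j : ℝ) + 1)) ?_ hx
      simpa using tendsto_const_nhds.add (tendsto_one_div_add_atTop_nhds_zero_nat (𝕜 := ℝ))
    · have : (0 : ℝ) < 1 / ((j : ℝ) + 1) := Nat.one_div_pos_of_nat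
      linarith
  have := tendsto_measure_iInter_atTop (μ := n) (s := fun j : ℕ => Iic (k + 1 / ((j : ℝ) + 1)))
    (fun _ => measurableSet_Iic.nullMeasurableSet)
    (fun i j hij => Iic_subset_Iic.2 (by gcongr)) ⟨0, hn _⟩
  rwa [hInter] at this

lemma measure_Iic_le_of_putPotential_eq {m n : Measure ℝ} (hm : ∀ k, putPotential m k ≠ ∞)
    (h : ∀ k, putPotential m k = putPotential n k) (k : ℝ) : m (Iic k) ≤ n (Iic k) := by
  have hn : ∀ k, putPotential n k ≠ ∞ := fun k => h k ▸ hm k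
  have key : ∀ j : ℕ, m (Iic k) ≤ n (Iic (k + 1 / ((j : ℝ) + 1))) := by
    intro j
    have hpos : (0 : ℝ) < 1 / ((j : ℝ) + 1) := Nat.one_div_pos_of_nat
    have h1 := (putPotential_add_le m (show k ≤ k + 1 / ((j : ℝ) + 1) by linarith)).trans
      ((h _).trans_le (putPotential_le_add n k (k + 1 / ((j : ℝ) + 1))))
    rw [h k, ENNReal.add_le_add_iff_left (hn k), add_sub_cancel_left,
      ENNReal.mul_le_mul_iff_right (by simpa using hpos) ENNReal.ofReal_ne_top] at h1
    exact h1
  exact ge_of_tendsto' (tendsto_measure_Iic_add_one_div (measure_Iic_ne_top hn) k) key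

/-- The put potential determines a finite measure: its right derivative is the distribution
function. -/
lemma eq_of_putPotential_eq {m n : Measure ℝ} [IsFiniteMeasure n]
    (hm : ∀ k, putPotential m k ≠ ∞) (h : ∀ k, putPotential m k = putPotential n k) : m = n := by
  have hIic : ∀ k, m (Iic k) = n (Iic k) := fun k =>
    (measure_Iic_le_of_putPotential_eq hm h k).antisymm
      (measure_Iic_le_of_putPotential_eq (fun k => h k ▸ hm k) (fun k => (h k).symm) k)
  have hfin : IsFiniteMeasure m := by
    constructor
    refine lt_of_le_of_lt ?_ (measure_lt_top n univ)
    refine le_of_tendsto (tendsto_measure_Iic_atTop m) (Eventually.of_forall fun k => ?_)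
    exact (hIic k).trans_le (measure_mono (subset_univ _))
  exact Measure.ext_of_Iic m n hIic

lemma eq_of_put_eq {m n : Measure ℝ} (hm : FiniteFirstMoment m) (hn : FiniteFirstMoment n)
    (h : ∀ k, put m k = put n k) : m = n := by
  have := hn.isFinite
  exact eq_of_putPotential_eq (putPotential_ne_top hm) fun k => by
    rw [← ofReal_put hm, ← ofReal_put hn, h]

lemma convexOn_put {m : Measure ℝ} (hm : FiniteFirstMoment m) : ConvexOn ℝ univ (put m) := by
  refine ⟨convex_univ, fun a _ b _ s t hs ht hst => ?_⟩
  simp only [put, smul_eq_mul]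
  rw [← integral_const_mul, ← integral_const_mul,
    ← integral_add ((hm.integrable_put a).const_mul s) ((hm.integrable_put b).const_mul t)]
  refine integral_mono (hm.integrable_put _)
    (((hm.integrable_put a).const_mul s).add ((hm.integrable_put b).const_mul t)) fun x => ?_
  refine max_le ?_ (by positivity)
  calc s * a + t * b - x = s * (a - x) + t * (b - x) := by linear_combination x * hst
    _ ≤ _ := by gcongr <;> exact le_max_left _ _

lemma tendsto_put_atBot {m : Measure ℝ} (hm : FiniteFirstMoment m) :
    Tendsto (put m) atBot (𝓝 0) := by
  have := hm.isFinite
  have h0 : (0 : ℝ) = ∫ _, (0 : ℝ) ∂m := by simp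
  rw [h0]
  refine tendsto_integral_filter_of_dominated_convergence (fun x => |x|) ?_ ?_ hm.integrable.abs ?_
  · exact Eventually.of_forall fun k => (hm.integrable_put k).aestronglyMeasurable
  · filter_upwards [eventually_le_atBot (0 : ℝ)] with k hk
    refine ae_of_all _ fun x => ?_
    rw [Real.norm_eq_abs, abs_of_nonneg (le_max_right _ _)]
    exact max_le (by linarith [neg_abs_le x]) (abs_nonneg _)
  · refine ae_of_all _ fun x => tendsto_const_nhds.congr' ?_
    filter_upwards [eventually_le_atBot x] with k hk
    exact (max_eq_right (by linarith)).symm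

/-- The slope of the put potential at `∞` is the total mass. -/
lemma measureReal_univ_le_of_put_le {m n : Measure ℝ} (hm : FiniteFirstMoment m)
    (hn : FiniteFirstMoment n) (h : ∀ k, put m k ≤ put n k) : m.real univ ≤ n.real univ := by
  have := hm.isFinite
  have := hn.isFinite
  by_contra! hlt
  have key : ∀ k : ℝ, 0 ≤ k → k * (m.real univ - n.real univ) ≤ (∫ x, x ∂m) + ∫ x, |x| ∂n := by
    intro k hk
    have h1 : k * m.real univ - ∫ x, x ∂m ≤ put m k := by
      have : k * m.real univ - ∫ x, x ∂m = ∫ x, (k - x) ∂m := by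
        rw [integral_sub (integrable_const k) hm.integrable]; simp [mul_comm]
      rw [this]
      exact integral_mono ((integrable_const k).sub hm.integrable) (hm.integrable_put k)
        fun x => le_max_left _ _
    have h2 : put n k ≤ k * n.real univ + ∫ x, |x| ∂n := by
      have : k * n.real univ + ∫ x, |x| ∂n = ∫ x, (k + |x|) ∂n := by
        rw [integral_add (integrable_const k) hn.integrable.abs]; simp [mul_comm]
      rw [this]
      exact integral_mono (hn.integrable_put k) ((integrable_const k).add hn.integrable.abs)
        fun x => max_le (by linarith [neg_abs_le x]) (by positivity)
    linarith [h k]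
  obtain ⟨j, hj⟩ := exists_nat_gt
    (((∫ x, x ∂m) + ∫ x, |x| ∂n) / (m.real univ - n.real univ))
  rw [div_lt_iff₀ (by linarith)] at hj
  exact absurd (key j j.cast_nonneg) (not_le.2 hj)

/-! ### Convex functions as put potentials -/

/-- Two functions on `[A, B]`whose difference quotients lie between the same lower and upper values
of a function `g` have the same increments: halving the interval halves the bound on the
discrepancy. -/
lemma sub_eq_sub_of_slope_bounds {u v g : ℝ → ℝ} {A B : ℝ} (hAB : A ≤ B)
    (hu : ∀ a b, A ≤ a → a ≤ b → b ≤ B → (b - a) * g a ≤ u b - u a ∧ u b - u a ≤ (b - a) * g b)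
    (hv : ∀ a b, A ≤ a → a ≤ b → b ≤ B → (b - a) * g a ≤ v b - v a ∧ v b - v a ≤ (b - a) * g b) :
    u B - u A = v B - v A := by
  have key : ∀ n : ℕ, ∀ a b, A ≤ a → a ≤ b → b ≤ B →
      |(u b - u a) - (v b - v a)| ≤ (b - a) * (g b - g a) / 2 ^ n := by
    intro n
    induction n with
    | zero =>
      intro a b ha hab hb
      have h1 := hu a b ha hab hb
      have h2 := hv a b ha hab hb
      rw [abs_le]
      constructor <;> simp only [pow_zero, div_one] <;> linarith
    | succ n ih =>
      intro a b ha hab hb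
      have h1 := ih a ((a + b) / 2) ha (by linarith) (by linarith)
      have h2 := ih ((a + b) / 2) b (by linarith) (by linarith) hb
      have e : (b - a) * (g b - g a) / 2 ^ (n + 1) =
          ((a + b) / 2 - a) * (g ((a + b) / 2) - g a) / 2 ^ n +
          (b - (a + b) / 2) * (g b - g ((a + b) / 2)) / 2 ^ n := by
        rw [pow_succ]; field_simp; ring
      rw [e]
      refine le_trans ?_ (add_le_add h1 h2)
      refine le_trans (le_of_eq ?_) (abs_add_le _ _)
      congr 1; ring
  have hlim : Tendsto (fun n : ℕ => (B - A) * (g B - g A) / 2 ^ n) atTop (𝓝 0) := by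
    simpa [div_eq_mul_inv] using
      (tendsto_pow_atTop_nhds_zero_of_lt_one (r := (2 : ℝ)⁻¹) (by norm_num) (by norm_num)).const_mul
        ((B - A) * (g B - g A))
  have := ge_of_tendsto' hlim fun n => key n A B le_rfl hAB le_rfl
  have := abs_eq_zero.1 (le_antisymm this (abs_nonneg _))
  linarith

/-- A convex function on the line has difference quotients between the values of a right-continuous
monotone function, its right derivative. -/
lemma exists_stieltjesFunction_slope_bounds {h : ℝ → ℝ} (hc : ConvexOn ℝ univ h) :
    ∃ G : StieltjesFunction ℝ, ∀ a b, a ≤ b →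
      (b - a) * G a ≤ h b - h a ∧ h b - h a ≤ (b - a) * G b := by
  set g : ℝ → ℝ := fun x => derivWithin h (Ioi x) x with hg
  have hmono : Monotone g := by
    have := hc.monotoneOn_rightDeriv
    rwa [interior_univ, monotoneOn_univ] at this
  have hlow : ∀ a b, a < b → (b - a) * g a ≤ h b - h a := by
    intro a b hab
    have := hc.rightDeriv_le_slope_of_mem_interior (by simp) (mem_univ b) hab
    rw [slope_def_field, le_div_iff₀ (by linarith)] at this
    linarith
  have hup : ∀ a b, a < b → h b - h a ≤ (b - a) * g b := by
    intro a b hab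
    have h1 := hc.slope_le_leftDeriv_of_mem_interior (mem_univ a) (by simp) hab
    have h2 := hc.leftDeriv_le_rightDeriv_of_mem_interior (x := b) (by simp)
    have := h1.trans h2
    rw [slope_def_field, div_le_iff₀ (by linarith)] at this
    linarith
  have hcont : Continuous h := continuousOn_univ.1 (hc.continuousOn isOpen_univ)
  refine ⟨hmono.stieltjesFunction, fun a b hab => ?_⟩
  rw [hmono.stieltjesFunction_eq, hmono.stieltjesFunction_eq]
  rcases hab.eq_or_lt with rfl | hab
  · simp
  constructor
  · have hl : Tendsto (fun x => (b - x) * Function.rightLim g a) (𝓝[>] a)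
        (𝓝 ((b - a) * Function.rightLim g a)) :=
      ((continuous_const.sub continuous_id).mul continuous_const).continuousAt.tendsto.mono_left
        nhdsWithin_le_nhds
    have hr : Tendsto (fun x => h b - h x) (𝓝[>] a) (𝓝 (h b - h a)) :=
      (continuous_const.sub hcont).continuousAt.tendsto.mono_left nhdsWithin_le_nhds
    refine le_of_tendsto_of_tendsto hl hr ?_
    filter_upwards [Ioo_mem_nhdsGT hab] with x hx
    refine le_trans ?_ (hlow x b hx.2)
    exact mul_le_mul_of_nonneg_left (hmono.rightLim_le hx.1) (by linarith [hx.2])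
  · refine (hup a b hab).trans ?_
    exact mul_le_mul_of_nonneg_left (hmono.le_rightLim le_rfl) (by linarith)

/-- Convex functions vanishing at `-∞` are put potentials: the measure is the second derivative. -/
lemma exists_putPotential_eq {h : ℝ → ℝ} (hc : ConvexOn ℝ univ h) (h0 : ∀ k, 0 ≤ h k)
    (hlim : Tendsto h atBot (𝓝 0)) :
    ∃ m : Measure ℝ, (∀ k, m (Iic k) ≠ ∞) ∧ ∀ k, putPotential m k = ENNReal.ofReal (h k) := by
  obtain ⟨G, hG⟩ := exists_stieltjesFunction_slope_bounds hc
  have hG0 : ∀ a, 0 ≤ G a := by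
    intro a
    by_contra! hneg
    -- a negative slope at `a` would force `h` to be unbounded near `-∞`
    have hlow : ∀ᶠ c in atBot, h a + 1 ≤ h c := by
      filter_upwards [eventually_le_atBot (a - (h a + 1) / (- G a)), eventually_le_atBot a]
        with c hc1 hc2
      have h1 := (hG c a hc2).2
      have h2 : (h a + 1) / (- G a) ≤ a - c := by linarith
      rw [div_le_iff₀ (by linarith)] at h2
      linarith [h0 a]
    have := ge_of_tendsto hlim hlow
    linarith [h0 a]
  have hGlim : Tendsto G atBot (𝓝 0) := by
    have hs : Tendsto (fun a => h (a + 1) - h a) atBot (𝓝 0) := by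
      simpa using (hlim.comp (tendsto_atBot_add_const_right _ 1 tendsto_id)).sub hlim
    refine tendsto_of_tendsto_of_tendsto_of_le_of_le tendsto_const_nhds hs hG0 fun a => ?_
    have := (hG a (a + 1) (by linarith)).1
    simpa using this
  set m := G.measure with hm
  have hIic : ∀ k, m (Iic k) = ENNReal.ofReal (G k) := fun k => by
    rw [hm, G.measure_Iic hGlim, sub_zero]
  have hfin : ∀ k, m (Iic k) ≠ ∞ := fun k => by rw [hIic]; exact ENNReal.ofReal_ne_top
  -- the part of `m` to the right of `a` has the potential `h k - h a - G a * (k - a)`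
  have hle_restrict : ∀ a k, a ≤ k →
      putPotential (m.restrict (Ioi a)) k ≤ ENNReal.ofReal (h k) := by
    intro a k hak
    set n := m.restrict (Ioi a) with hn
    have hnIic : ∀ x, a ≤ x → n (Iic x) = ENNReal.ofReal (G x - G a) := by
      intro x hx
      rw [hn, Measure.restrict_apply measurableSet_Iic, inter_comm, Ioi_inter_Iic, hm,
        G.measure_Ioc]
    have hna : putPotential n a = 0 := by
      rw [putPotential, hn, setLIntegral_eq_zero_iff measurableSet_Ioi (by fun_prop)]
      exact ae_of_all _ fun x hx => ENNReal.ofReal_of_nonpos (by simp at hx; linarith)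
    have hnfin : ∀ x, a ≤ x → putPotential n x ≠ ∞ := by
      intro x hx
      refine ne_top_of_le_ne_top ?_ (putPotential_le_add n a x)
      rw [hna, hnIic x hx, zero_add]
      exact ENNReal.mul_ne_top ENNReal.ofReal_ne_top ENNReal.ofReal_ne_top
    have heq := sub_eq_sub_of_slope_bounds (u := fun x => (putPotential n x).toReal)
      (v := fun x => h x - G a * x) (g := fun x => G x - G a) hak ?_ ?_
    · simp only [hna, ENNReal.toReal_zero, sub_zero] at heq
      rw [← ENNReal.ofReal_toReal (hnfin k hak), heq]
      refine ENNReal.ofReal_le_ofReal ?_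
      nlinarith [h0 a, mul_nonneg (hG0 a) (sub_nonneg.2 hak)]
    · intro x y hax hxy hyk
      exact toReal_putPotential_slope_bounds hxy (hnfin x hax) (hnfin y (hax.trans hxy))
        (hnIic x hax) (hnIic y (hax.trans hxy)) (sub_nonneg.2 (G.mono hax))
        (sub_nonneg.2 (G.mono (hax.trans hxy)))
    · intro x y hax hxy hyk
      have := hG x y hxy
      constructor <;> linarith
  have hle : ∀ k, putPotential m k ≤ ENNReal.ofReal (h k) := by
    intro k
    have hlim := tendsto_measure_Ici_atBot (m.withDensity fun x => ENNReal.ofReal (k - x))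
    rw [withDensity_apply _ .univ, setLIntegral_univ] at hlim
    refine le_of_tendsto hlim ?_
    filter_upwards [eventually_le_atBot k] with a ha
    refine le_trans ?_ (hle_restrict (a - 1) k (by linarith))
    rw [putPotential, ← withDensity_apply _ measurableSet_Ioi]
    exact measure_mono (Ici_subset_Ioi.2 (by linarith))
  refine ⟨m, hfin, fun k => ?_⟩
  have hUfin : ∀ x, putPotential m x ≠ ∞ := fun x =>
    ne_top_of_le_ne_top ENNReal.ofReal_ne_top (hle x)
  have hincr : ∀ a, a ≤ k →
      (putPotential m k).toReal - (putPotential m a).toReal = h k - h a := by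
    intro a hak
    refine sub_eq_sub_of_slope_bounds (u := fun x => (putPotential m x).toReal) (v := h) (g := G)
      hak ?_ fun x y _ hxy _ => hG x y hxy
    intro x y _ hxy _
    exact toReal_putPotential_slope_bounds hxy (hUfin x) (hUfin y) (hIic x) (hIic y) (hG0 x) (hG0 y)
  have hlimU : Tendsto (fun a => (putPotential m a).toReal) atBot (𝓝 0) := by
    refine tendsto_of_tendsto_of_tendsto_of_le_of_le tendsto_const_nhds hlim
      (fun _ => ENNReal.toReal_nonneg) fun a => ENNReal.toReal_le_of_le_ofReal (h0 a) (hle a)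
  have hconst : Tendsto (fun a => (putPotential m k).toReal - (putPotential m a).toReal) atBot
      (𝓝 (h k - 0)) :=
    (tendsto_const_nhds.sub hlim).congr' <| by
      filter_upwards [eventually_le_atBot k] with a ha using (hincr a ha).symm
  have := tendsto_nhds_unique hconst (tendsto_const_nhds.sub hlimU)
  rw [← ENNReal.ofReal_toReal (hUfin k)]
  congr 1
  linarith

/-! ### The convex-decreasing order in terms of potentials -/

namespace ConvexDecreasingLE

variable {μ ν : Measure ℝ}

lemma measureReal_univ_eq (h : ConvexDecreasingLE μ ν) : μ.real univ = ν.real univ := by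
  have := h.left.isFinite
  have := h.right.isFinite
  have h1 := (h.integral_le (fun _ => 1) (convexOn_const 1 convex_univ) antitone_const
    (integrable_const _)).2
  have h2 := (h.integral_le (fun _ => -1) (convexOn_const (-1) convex_univ) antitone_const
    (integrable_const _)).2
  simp only [integral_const, smul_eq_mul, mul_one, mul_neg] at h1 h2
  linarith

lemma put_le (h : ConvexDecreasingLE μ ν) (k : ℝ) : put μ k ≤ put ν k := by
  refine (h.integral_le (fun x => max (k - x) 0) ?_ ?_ (h.right.integrable_put k)).2
  · refine ConvexOn.sup ?_ (convexOn_const 0 convex_univ)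
    refine ⟨convex_univ, fun a _ b _ s t _ _ hst => ?_⟩
    simp only [smul_eq_mul]
    exact le_of_eq (by linear_combination (-k) * hst)
  · intro a b hab
    exact max_le_max (by linarith) le_rfl

/-- Moving up in the convex-decreasing order decreases the barycentre. -/
lemma integral_id_le (h : ConvexDecreasingLE μ ν) : ∫ x, x ∂ν ≤ ∫ x, x ∂μ := by
  have h1 := (h.integral_le (fun x => -x) ?_ (fun a b hab => neg_le_neg hab)
    h.right.integrable.neg).2
  · rw [integral_neg, integral_neg] at h1
    linarith
  · refine ⟨convex_univ, fun a _ b _ s t _ _ hst => ?_⟩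
    simp only [smul_eq_mul]
    exact le_of_eq (by ring)

end ConvexDecreasingLE

/-- A convex antitone function that is bounded below by `0` and vanishes on a right half-line is a
mixture of put payoffs, so put potentials control its integral. -/
lemma lintegral_le_of_put_le {μ ν : Measure ℝ} (hμ : FiniteFirstMoment μ)
    (hν : FiniteFirstMoment ν) (h : ∀ k, put μ k ≤ put ν k) {ψ : ℝ → ℝ}
    (hc : ConvexOn ℝ univ ψ) (h0 : ∀ x, 0 ≤ ψ x) {n : ℝ} (hn : ∀ x, n ≤ x → ψ x = 0) :
    ∫⁻ x, ENNReal.ofReal (ψ x) ∂μ ≤ ∫⁻ x, ENNReal.ofReal (ψ x) ∂ν := by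
  have hcneg : ConvexOn ℝ univ fun k => ψ (-k) := by
    refine ⟨convex_univ, fun a _ b _ s t hs ht hst => ?_⟩
    have := hc.2 (mem_univ (-a)) (mem_univ (-b)) hs ht hst
    simp only [smul_eq_mul] at this ⊢
    convert this using 2
    ring
  have hlim : Tendsto (fun k => ψ (-k)) atBot (𝓝 0) := by
    refine tendsto_const_nhds.congr' ?_
    filter_upwards [eventually_le_atBot (-n)] with k hk
    exact (hn _ (by linarith)).symm
  obtain ⟨m, hm, hmU⟩ := exists_putPotential_eq hcneg (fun k => h0 _) hlim
  have hσ : SigmaFinite m := by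
    refine ⟨⟨⟨fun j => Iic (j : ℝ), fun _ => trivial, fun j => (hm _).lt_top, ?_⟩⟩⟩
    refine eq_univ_of_forall fun x => mem_iUnion.2 ?_
    obtain ⟨j, hj⟩ := exists_nat_gt x
    exact ⟨j, hj.le⟩
  have key : ∀ ρ : Measure ℝ, FiniteFirstMoment ρ →
      ∫⁻ x, ENNReal.ofReal (ψ x) ∂ρ = ∫⁻ y, ENNReal.ofReal (put ρ (-y)) ∂m := by
    intro ρ hρ
    have := hρ.isFinite
    calc ∫⁻ x, ENNReal.ofReal (ψ x) ∂ρ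
        = ∫⁻ x, ∫⁻ y, ENNReal.ofReal (-x - y) ∂m ∂ρ := by
          refine lintegral_congr fun x => ?_
          have := hmU (-x)
          rw [neg_neg] at this
          exact this.symm
      _ = ∫⁻ y, ∫⁻ x, ENNReal.ofReal (-x - y) ∂ρ ∂m :=
          lintegral_lintegral_swap (by fun_prop)
      _ = _ := by
          refine lintegral_congr fun y => ?_
          rw [ofReal_put hρ, putPotential]
          exact lintegral_congr fun x => by congr 1; ring
  rw [key μ hμ, key ν hν]
  exact lintegral_mono fun y => ENNReal.ofReal_le_ofReal (h _)

/-- The convex-decreasing order is the order of put potentials between measures of equal mass. -/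
theorem convexDecreasingLE_of_put_le {μ ν : Measure ℝ} (hμ : FiniteFirstMoment μ)
    (hν : FiniteFirstMoment ν) (hmass : μ.real univ = ν.real univ)
    (h : ∀ k, put μ k ≤ put ν k) : ConvexDecreasingLE μ ν := by
  have := hμ.isFinite
  have := hν.isFinite
  refine ⟨hμ, hν, fun φ hc hanti hint => ?_⟩
  have hmeas : Measurable φ := hanti.measurable
  -- the truncations `max φ (φ n)` decrease to `φ`
  have htrunc : ∀ n : ℝ, Integrable (fun x => max (φ x) (φ n)) ν ∧
      Integrable (fun x => max (φ x) (φ n)) μ ∧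
      ∫ x, max (φ x) (φ n) ∂μ ≤ ∫ x, max (φ x) (φ n) ∂ν := by
    intro n
    have hν1 : Integrable (fun x => max (φ x) (φ n)) ν := hint.sup (integrable_const _)
    have hν2 : Integrable (fun x => max (φ x) (φ n) - φ n) ν := hν1.sub (integrable_const _)
    have hψ0 : ∀ x, 0 ≤ max (φ x) (φ n) - φ n := fun x => sub_nonneg.2 (le_max_right _ _)
    have hψm : Measurable fun x => max (φ x) (φ n) - φ n :=
      (hmeas.max measurable_const).sub_const _
    have hle := lintegral_le_of_put_le hμ hν h (ψ := fun x => max (φ x) (φ n) - φ n) (n := n)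
      ((hc.sup (convexOn_const (φ n) convex_univ)).sub (concaveOn_const (φ n) convex_univ)) hψ0
      (fun x hx => by rw [max_eq_right (hanti hx), sub_self])
    have hμ2 : Integrable (fun x => max (φ x) (φ n) - φ n) μ := by
      refine ⟨hψm.aestronglyMeasurable, ?_⟩
      rw [hasFiniteIntegral_iff_ofReal (ae_of_all _ hψ0)]
      refine hle.trans_lt ?_
      rw [← hasFiniteIntegral_iff_ofReal (ae_of_all _ hψ0)]
      exact hν2.2
    have hμ1 : Integrable (fun x => max (φ x) (φ n)) μ := by
      exact (hμ2.add (integrable_const (φ n))).congr (ae_of_all _ fun x => by simp)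
    refine ⟨hν1, hμ1, ?_⟩
    have hle' : ∫ x, (max (φ x) (φ n) - φ n) ∂μ ≤ ∫ x, (max (φ x) (φ n) - φ n) ∂ν := by
      rw [integral_eq_lintegral_of_nonneg_ae (ae_of_all _ hψ0) hψm.aestronglyMeasurable,
        integral_eq_lintegral_of_nonneg_ae (ae_of_all _ hψ0) hψm.aestronglyMeasurable]
      refine ENNReal.toReal_mono ?_ hle
      exact ((hasFiniteIntegral_iff_ofReal (ae_of_all _ hψ0)).1 hν2.2).ne
    rw [integral_sub hμ1 (integrable_const _), integral_sub hν1 (integrable_const _)] at hle'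
    simp only [integral_const, smul_eq_mul, hmass] at hle'
    linarith
  have hφμ : Integrable φ μ := by
    -- `φ` lies between a supporting line at `0` and a truncation
    obtain ⟨G, hG⟩ := exists_stieltjesFunction_slope_bounds hc
    have hlow : Integrable (fun x => φ 0 + G 0 * x) μ :=
      (integrable_const _).add (hμ.integrable.const_mul _)
    refine ((htrunc 0).2.1.abs.add hlow.abs).mono' hmeas.aestronglyMeasurable
      (ae_of_all _ fun x => ?_)
    have h1 : φ 0 + G 0 * x ≤ φ x := by
      rcases le_total 0 x with hx | hx
      · linarith [(hG 0 x hx).1]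
      · linarith [(hG x 0 hx).2]
    have h2 : φ x ≤ max (φ x) (φ 0) := le_max_left _ _
    simp only [Pi.add_apply, Real.norm_eq_abs]
    rw [abs_le]
    constructor
    · linarith [neg_abs_le (φ 0 + G 0 * x), abs_nonneg (max (φ x) (φ 0))]
    · linarith [le_abs_self (max (φ x) (φ 0)), abs_nonneg (φ 0 + G 0 * x)]
  refine ⟨hφμ, ?_⟩
  have hlim : Tendsto (fun n : ℕ => ∫ x, max (φ x) (φ n) ∂ν) atTop (𝓝 (∫ x, φ x ∂ν)) := by
    refine tendsto_integral_of_dominated_convergence (fun x => |φ x| + |φ 0|)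
      (fun n => (hmeas.max measurable_const).aestronglyMeasurable)
      (hint.abs.add (integrable_const _)) (fun n => ae_of_all _ fun x => ?_)
      (ae_of_all _ fun x => ?_)
    · have h1 : φ n ≤ φ 0 := hanti n.cast_nonneg
      rw [Real.norm_eq_abs, abs_le]
      constructor
      · linarith [neg_abs_le (φ x), le_max_left (φ x) (φ n), abs_nonneg (φ 0)]
      · refine max_le ?_ ?_
        · linarith [le_abs_self (φ x), abs_nonneg (φ 0)]
        · linarith [le_abs_self (φ 0), abs_nonneg (φ x)]
    · refine tendsto_const_nhds.congr' ?_
      obtain ⟨N, hN⟩ := exists_nat_gt x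
      filter_upwards [eventually_ge_atTop N] with n hn
      have : (N : ℝ) ≤ n := by exact_mod_cast hn
      exact (max_eq_left (hanti (by linarith))).symm
  refine ge_of_tendsto' hlim fun n => ?_
  exact (integral_mono hφμ (htrunc n).2.1 fun x => le_max_left _ _).trans
    (htrunc n).2.2

/-! ### Greatest convex minorants of differences of convex functions -/

/-- A function on the line with a convex minorant has a greatest one. -/
lemma exists_greatest_convex_minorant {F c₀ : ℝ → ℝ} (hc₀ : ConvexOn ℝ univ c₀)
    (h₀ : ∀ x, c₀ x ≤ F x) :
    ∃ D : ℝ → ℝ, ConvexOn ℝ univ D ∧ (∀ x, D x ≤ F x) ∧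
      ∀ c : ℝ → ℝ, ConvexOn ℝ univ c → (∀ x, c x ≤ F x) → ∀ x, c x ≤ D x := by
  let S := {c : ℝ → ℝ // ConvexOn ℝ univ c ∧ ∀ x, c x ≤ F x}
  have : Nonempty S := ⟨⟨c₀, hc₀, h₀⟩⟩
  have hbdd : ∀ x, BddAbove (range fun c : S => c.1 x) := fun x =>
    ⟨F x, by rintro _ ⟨c, rfl⟩; exact c.2.2 x⟩
  refine ⟨fun x => ⨆ c : S, c.1 x, ⟨convex_univ, fun a _ b _ s t hs ht hst => ?_⟩,
    fun x => ciSup_le fun c => c.2.2 x, fun c hc hcF x => le_ciSup (hbdd x) ⟨c, hc, hcF⟩⟩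
  refine ciSup_le fun c => (c.2.1.2 (mem_univ a) (mem_univ b) hs ht hst).trans ?_
  simp only [smul_eq_mul]
  gcongr
  · exact le_ciSup (hbdd a) c
  · exact le_ciSup (hbdd b) c

/-- Where the greatest convex minorant `D` of `F` lies strictly below `F`, it is affine at small
scales: otherwise raising it to a short chord would give a larger convex minorant. -/
lemma exists_midpoint_le_of_greatest_convex_minorant {F D : ℝ → ℝ} (hF : Continuous F)
    (hD : ConvexOn ℝ univ D) (hDF : ∀ x, D x ≤ F x)
    (hmax : ∀ c : ℝ → ℝ, ConvexOn ℝ univ c → (∀ x, c x ≤ F x) → ∀ x, c x ≤ D x) {c : ℝ}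
    (hc : D c < F c) {ε : ℝ} (hε : 0 < ε) :
    ∃ δ, 0 < δ ∧ δ < ε ∧ D (c - δ) + D (c + δ) ≤ 2 * D c := by
  have hDc : Continuous D := continuousOn_univ.1 (hD.continuousOn isOpen_univ)
  obtain ⟨r, hr1, hr2⟩ := exists_between hc
  have hev : ∀ᶠ x in 𝓝 c, r < F x ∧ D x < r :=
    (hF.continuousAt.eventually_const_lt hr2).and (hDc.continuousAt.eventually_lt_const hr1)
  obtain ⟨η, hη, hball⟩ := Metric.eventually_nhds_iff.1 hev
  set δ := min η ε / 2 with hδ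
  have hmin : 0 < min η ε := lt_min hη hε
  have hδ0 : 0 < δ := by positivity
  have hδη : δ < η := by linarith [min_le_left η ε]
  have hδε : δ < ε := by linarith [min_le_right η ε]
  have hnear : ∀ x, c - δ ≤ x → x ≤ c + δ → r < F x ∧ D x < r := fun x h1 h2 =>
    hball (by rw [Real.dist_eq, abs_lt]; constructor <;> linarith)
  have hD1 := (hnear (c - δ) le_rfl (by linarith)).2
  have hD2 := (hnear (c + δ) (by linarith) le_rfl).2
  refine ⟨δ, hδ0, hδε, ?_⟩
  -- the maximum of `D` and the chord of `D` over `[c - δ, c + δ]` is still a convex minorant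
  set κ := (D (c + δ) - D (c - δ)) / (2 * δ) with hκ
  have hκδ : κ * (2 * δ) = D (c + δ) - D (c - δ) := by rw [hκ]; field_simp
  have hconv : ConvexOn ℝ univ fun x => max (D x) (D (c - δ) + κ * (x - (c - δ))) := by
    refine hD.sup ⟨convex_univ, fun a _ b _ s t _ _ hst => ?_⟩
    simp only [smul_eq_mul]
    exact le_of_eq (by linear_combination (κ * (c - δ) - D (c - δ)) * hst)
  have hle := hmax _ hconv ?_ c
  · have := (le_max_right _ _).trans hle
    linarith
  · intro x
    refine max_le (hDF x) ?_
    rcases lt_or_ge x (c - δ) with h1 | h1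
    · refine le_trans ?_ (hDF x)
      have := hD.slope_mono_adjacent (mem_univ x) (mem_univ (c + δ)) h1 (by linarith)
      rw [show c + δ - (c - δ) = 2 * δ by ring, ← hκ, div_le_iff₀ (by linarith)] at this
      linarith
    rcases lt_or_ge (c + δ) x with h2 | h2
    · refine le_trans ?_ (hDF x)
      have := hD.slope_mono_adjacent (mem_univ (c - δ)) (mem_univ x) (by linarith) h2
      rw [show c + δ - (c - δ) = 2 * δ by ring, ← hκ, le_div_iff₀ (by linarith)] at this
      linarith
    · refine le_trans ?_ (hnear x h1 h2).1.le
      rcases le_total 0 κ with h3 | h3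
      · nlinarith
      · nlinarith

/-- If `D` is the greatest convex minorant of the difference `g - f` of convex functions, then
`g - D` is convex. On a chord interval, look at the leftmost point where `g - D` most exceeds the
chord: `D` touches `g - f` there, against convexity of `f`, or `D` is affine near it, against
convexity of `g`. -/
lemma convexOn_sub_greatest_convex_minorant {f g D : ℝ → ℝ} (hf : ConvexOn ℝ univ f)
    (hg : ConvexOn ℝ univ g) (hD : ConvexOn ℝ univ D) (hDF : ∀ x, D x ≤ g x - f x)
    (hmax : ∀ c : ℝ → ℝ, ConvexOn ℝ univ c → (∀ x, c x ≤ g x - f x) → ∀ x, c x ≤ D x) :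
    ConvexOn ℝ univ fun x => g x - D x := by
  have hfc : Continuous f := continuousOn_univ.1 (hf.continuousOn isOpen_univ)
  have hgc : Continuous g := continuousOn_univ.1 (hg.continuousOn isOpen_univ)
  have hDc : Continuous D := continuousOn_univ.1 (hD.continuousOn isOpen_univ)
  refine LinearOrder.convexOn_of_lt convex_univ fun a _ b _ hab s t hs ht hst => ?_
  simp only [smul_eq_mul]
  by_contra! hlt
  set κ := ((g b - D b) - (g a - D a)) / (b - a) with hκ
  have hκ' : κ * (b - a) = (g b - D b) - (g a - D a) := by
    rw [hκ]; exact div_mul_cancel₀ _ (by linarith)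
  set W : ℝ → ℝ := fun x => g x - D x - (g a - D a + κ * (x - a)) with hW
  have hWc : Continuous W := by fun_prop
  have hWa : W a = 0 := by simp [hW]
  have hWb : W b = 0 := by simp only [hW]; linarith
  have hmem : s * a + t * b ∈ Icc a b :=
    convex_Icc a b (left_mem_Icc.2 hab.le) (right_mem_Icc.2 hab.le) hs.le ht.le hst
  have hWpos : 0 < W (s * a + t * b) := by
    have e : κ * (s * a + t * b - a) = t * ((g b - D b) - (g a - D a)) := by
      rw [← hκ']; linear_combination κ * a * hst
    simp only [hW]
    rw [e]
    have e2 : s * (g a - D a) = (1 - t) * (g a - D a) := by rw [← hst]; ring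
    linarith
  obtain ⟨c', hc', hc'max⟩ := isCompact_Icc.exists_isMaxOn ⟨_, hmem⟩ hWc.continuousOn
  have hcomp : IsCompact (Icc a b ∩ W ⁻¹' {W c'}) :=
    isCompact_Icc.inter_right (isClosed_singleton.preimage hWc)
  obtain ⟨c, ⟨hc, hcW⟩, hcleast⟩ := hcomp.exists_isLeast ⟨c', hc', rfl⟩
  have hcW : W c = W c' := hcW
  have hcmax : ∀ x ∈ Icc a b, W x ≤ W c := fun x hx => hcW ▸ hc'max hx
  have hcpos : 0 < W c := hWpos.trans_le (hcmax _ hmem)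
  have hac : a < c := lt_of_le_of_ne hc.1 fun h => by rw [← h, hWa] at hcpos; exact hcpos.false
  have hcb : c < b := lt_of_le_of_ne hc.2 fun h => by rw [h, hWb] at hcpos; exact hcpos.false
  rcases (hDF c).eq_or_lt with heq | hlt'
  · have hchord := hf.slope_mono_adjacent (mem_univ a) (mem_univ b) hac hcb
    rw [div_le_div_iff₀ (by linarith) (by linarith)] at hchord
    have hWc' : f c - (g a - D a + κ * (c - a)) > 0 := by
      simp only [hW] at hcpos; linarith
    have h1 : f a ≤ g a - D a := by linarith [hDF a]
    have h2 : f b ≤ g b - D b := by linarith [hDF b]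
    have h3 := mul_pos hWc' (sub_pos.2 hab)
    have e : κ * (c - a) * (b - a) = (c - a) * ((g b - D b) - (g a - D a)) := by
      rw [← hκ']; ring
    nlinarith [mul_le_mul_of_nonneg_left h1 (sub_nonneg.2 hcb.le),
      mul_le_mul_of_nonneg_left h2 (sub_nonneg.2 hac.le)]
  · obtain ⟨δ, hδ0, hδε, hmid⟩ := exists_midpoint_le_of_greatest_convex_minorant
      (F := fun x => g x - f x) (hgc.sub hfc) hD hDF hmax hlt'
      (ε := min (c - a) (b - c)) (lt_min (by linarith) (by linarith))
    have hδ1 := hδε.trans_le (min_le_left _ _)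
    have hδ2 := hδε.trans_le (min_le_right _ _)
    have hm1 : c - δ ∈ Icc a b := ⟨by linarith, by linarith⟩
    have hm2 : c + δ ∈ Icc a b := ⟨by linarith, by linarith⟩
    have hW1 : W (c - δ) < W c := by
      refine lt_of_le_of_ne (hcmax _ hm1) fun h => ?_
      have := hcleast ⟨hm1, h.trans hcW⟩
      linarith
    have hW2 := hcmax _ hm2
    have hgmid : 2 * g c ≤ g (c - δ) + g (c + δ) := by
      have := hg.2 (mem_univ (c - δ)) (mem_univ (c + δ)) (by norm_num : (0 : ℝ) ≤ 1 / 2)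
        (by norm_num : (0 : ℝ) ≤ 1 / 2) (by norm_num)
      simp only [smul_eq_mul] at this
      rw [show 1 / 2 * (c - δ) + 1 / 2 * (c + δ) = c by ring] at this
      linarith
    simp only [hW] at hW1 hW2
    nlinarith

/-! ### Shadows -/

/-- `σ` is a shadow of `μ` in `ν` in terms of potentials: `put ν - put σ` dominates every convex
minorant of `put ν - put μ`. -/
structure IsPutShadow (μ ν σ : Measure ℝ) : Prop where
  cd_le : ConvexDecreasingLE μ σ
  le : σ ≤ ν
  add_put_le : ∀ c : ℝ → ℝ, ConvexOn ℝ univ c → (∀ k, c k + put μ k ≤ put ν k) →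
    ∀ k, c k + put σ k ≤ put ν k

lemma exists_eq_add_of_measure_le {θ ν : Measure ℝ} (hν : FiniteFirstMoment ν) (h : θ ≤ ν) :
    ∃ τ, FiniteFirstMoment τ ∧ ν = θ + τ := by
  have := hν.isFinite
  have := (hν.mono h).isFinite
  exact ⟨ν - θ, hν.mono Measure.sub_le, by rw [add_comm, Measure.sub_add_cancel_of_le h]⟩

lemma measureReal_univ_add {m n : Measure ℝ} (hm : FiniteFirstMoment m)
    (hn : FiniteFirstMoment n) : (m + n).real univ = m.real univ + n.real univ := by
  have := hm.isFinite
  have := hn.isFinite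
  exact measureReal_add_apply

namespace IsPutShadow

variable {μ ν σ : Measure ℝ}

lemma isShadow (h : IsPutShadow μ ν σ) (hν : FiniteFirstMoment ν) : IsShadow μ ν σ := by
  refine ⟨⟨h.cd_le.right, h.cd_le, h.le⟩, fun θ ⟨hθ, hμθ, hθν⟩ => ?_⟩
  obtain ⟨τ, hτ, rfl⟩ := exists_eq_add_of_measure_le hν hθν
  refine convexDecreasingLE_of_put_le h.cd_le.right hθ
    (h.cd_le.measureReal_univ_eq.symm.trans hμθ.measureReal_univ_eq) fun k => ?_
  have := h.add_put_le (put τ) (convexOn_put hτ) (fun k => by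
    rw [put_add hθ hτ]; linarith [hμθ.put_le k]) k
  rw [put_add hθ hτ] at this
  linarith

/-- Shadows can be taken in stages: the part `μ'` is projected onto what the shadow of `μ` leaves of
the target. -/
lemma add {μ' τ σ' : Measure ℝ} (h : IsPutShadow μ (σ + τ) σ) (h' : IsPutShadow μ' τ σ')
    (hτ : FiniteFirstMoment τ) : IsPutShadow (μ + μ') (σ + τ) (σ + σ') := by
  have hμ := h.cd_le.left
  have hσ := h.cd_le.right
  have hμ' := h'.cd_le.left
  have hσ' := h'.cd_le.right
  refine ⟨convexDecreasingLE_of_put_le (hμ.add hμ') (hσ.add hσ') ?_ fun k => ?_,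
    add_le_add le_rfl h'.le, fun c hc hle k => ?_⟩
  · rw [measureReal_univ_add hμ hμ', measureReal_univ_add hσ hσ', h.cd_le.measureReal_univ_eq,
      h'.cd_le.measureReal_univ_eq]
  · rw [put_add hμ hμ', put_add hσ hσ']
    exact add_le_add (h.cd_le.put_le k) (h'.cd_le.put_le k)
  · have h1 := h.add_put_le (fun k => c k + put μ' k) (hc.add (convexOn_put hμ')) fun k => by
      have := hle k
      rw [put_add hμ hμ'] at this
      linarith
    have h2 := h'.add_put_le c hc (fun k => by
      have := h1 k
      rw [put_add hσ hτ] at this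
      linarith) k
    rw [put_add hσ hτ, put_add hσ hσ']
    linarith

end IsPutShadow

/-- A shadow of `μ` in `ν` exists as soon as some `ρ` can complement `μ` to a measure below `ν` in
the convex-decreasing order. Its potential is `put ν - D`, where `D` is the greatest convex minorant
of `put ν - put μ`; the comparison with `put ρ` gives `D` the right slope at `∞`. -/
lemma exists_isPutShadow {μ ρ ν : Measure ℝ} (hμ : FiniteFirstMoment μ) (hρ : FiniteFirstMoment ρ)
    (hν : FiniteFirstMoment ν) (hmass : μ.real univ + ρ.real univ = ν.real univ)
    (h : ∀ k, put μ k + put ρ k ≤ put ν k) : ∃ σ, IsPutShadow μ ν σ := by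
  obtain ⟨D, hDc, hDF, hmax⟩ := exists_greatest_convex_minorant (F := fun k => put ν k - put μ k)
    (convexOn_put hρ) (fun k => by linarith [h k])
  have hHc := convexOn_sub_greatest_convex_minorant (convexOn_put hμ) (convexOn_put hν) hDc hDF hmax
  have hρD : ∀ k, put ρ k ≤ D k := hmax _ (convexOn_put hρ) fun k => by linarith [h k]
  have hD0 : ∀ k, 0 ≤ D k := fun k => (put_nonneg ρ k).trans (hρD k)
  have hμH : ∀ k, put μ k ≤ put ν k - D k := fun k => by linarith [hDF k]
  have hH0 : ∀ k, 0 ≤ put ν k - D k := fun k => (put_nonneg μ k).trans (hμH k)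
  obtain ⟨τ, -, hτ⟩ := exists_putPotential_eq hDc hD0 <|
    tendsto_of_tendsto_of_tendsto_of_le_of_le tendsto_const_nhds (tendsto_put_atBot hν) hD0
      fun k => by linarith [hH0 k]
  obtain ⟨σ, -, hσ⟩ := exists_putPotential_eq hHc hH0 <|
    tendsto_of_tendsto_of_tendsto_of_le_of_le tendsto_const_nhds (tendsto_put_atBot hν) hH0
      fun k => by linarith [hD0 k]
  have hsum : σ + τ = ν := by
    have := hν.isFinite
    have hU : ∀ k, putPotential (σ + τ) k = putPotential ν k := fun k => by
      rw [putPotential_add, hτ, hσ, ← ENNReal.ofReal_add (hH0 k) (hD0 k), ← ofReal_put hν]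
      congr 1; ring
    exact eq_of_putPotential_eq (fun k => hU k ▸ putPotential_ne_top hν k) hU
  have hσm : FiniteFirstMoment σ := FiniteFirstMoment.of_add_left (hsum ▸ hν)
  have hτm : FiniteFirstMoment τ := FiniteFirstMoment.of_add_right (hsum ▸ hν)
  have hputσ : ∀ k, put σ k = put ν k - D k := fun k =>
    (ENNReal.ofReal_eq_ofReal_iff (put_nonneg σ k) (hH0 k)).1 ((ofReal_put hσm k).trans (hσ k))
  have hputτ : ∀ k, put τ k = D k := fun k =>
    (ENNReal.ofReal_eq_ofReal_iff (put_nonneg τ k) (hD0 k)).1 ((ofReal_put hτm k).trans (hτ k))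
  refine ⟨σ, convexDecreasingLE_of_put_le hμ hσm ?_ fun k => (hμH k).trans_eq (hputσ k).symm,
    hsum ▸ Measure.le_add_right le_rfl, fun c hc hle k => ?_⟩
  · have h1 := measureReal_univ_le_of_put_le hμ hσm fun k => (hμH k).trans_eq (hputσ k).symm
    have h2 := measureReal_univ_le_of_put_le hρ hτm fun k => (hρD k).trans_eq (hputτ k).symm
    have h3 := measureReal_univ_add hσm hτm
    rw [hsum] at h3
    linarith
  · have := hmax c hc (fun k => by linarith [hle k]) k
    rw [hputσ]
    linarith

lemma IsShadow.eq {μ ν σ σ' : Measure ℝ} (h : IsShadow μ ν σ) (h' : IsShadow μ ν σ') : σ = σ' :=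
  eq_of_put_eq h.mem.1 h'.mem.1 fun k =>
    ((h.least _ h'.mem).put_le k).antisymm ((h'.least _ h.mem).put_le k)

lemma IsShadow.shadow_eq {μ ν σ : Measure ℝ} (h : IsShadow μ ν σ) : shadow μ ν = σ := by
  have hex : ∃ σ, IsShadow μ ν σ := ⟨σ, h⟩
  rw [shadow, dif_pos hex]
  exact hex.choose_spec.eq h

/-- The shadows of the growing parts `μ₁ ≤ μ₁ + μ₂` of a measure `μ₁ + μ₂ + μ₃ ≤_cd ν` grow, and the
increment of the shadow dominates the increment `μ₂` in the convex-decreasing order. -/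
lemma exists_isShadow_add {μ₁ μ₂ μ₃ ν : Measure ℝ} (h : ConvexDecreasingLE (μ₁ + μ₂ + μ₃) ν) :
    ∃ σ τ, IsShadow μ₁ ν σ ∧ IsShadow (μ₁ + μ₂) ν (σ + τ) ∧ ConvexDecreasingLE μ₂ τ := by
  have hν := h.right
  have h3 := h.left.of_add_right
  have h12 := h.left.of_add_left
  have h1 := h12.of_add_left
  have h2 := h12.of_add_right
  have hmass := h.measureReal_univ_eq
  rw [measureReal_univ_add h12 h3, measureReal_univ_add h1 h2] at hmass
  have hput := h.put_le
  simp only [put_add h12 h3, put_add h1 h2] at hput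
  obtain ⟨σ, hσ⟩ := exists_isPutShadow h1 (h2.add h3) hν
    (by rw [measureReal_univ_add h2 h3]; linarith)
    (fun k => by rw [put_add h2 h3]; linarith [hput k])
  obtain ⟨ρ, hρ, rfl⟩ := exists_eq_add_of_measure_le hν hσ.le
  have hσm := hσ.cd_le.right
  have hres := hσ.add_put_le (put (μ₂ + μ₃)) (convexOn_put (h2.add h3))
    (fun k => by rw [put_add h2 h3]; linarith [hput k])
  obtain ⟨τ, hτ⟩ := exists_isPutShadow h2 h3 hρ
    (by rw [measureReal_univ_add hσm hρ, ← hσ.cd_le.measureReal_univ_eq] at hmass; linarith)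
    (fun k => by have := hres k; rw [put_add h2 h3, put_add hσm hρ] at this; linarith)
  exact ⟨σ, τ, hσ.isShadow hν, (hσ.add hτ hρ).isShadow hν, hτ.cd_le⟩

/-! ### Testing signed densities on intervals -/

/-- Half-open intervals detect the setwise order of finite measures: the difference of the
distribution functions is then monotone, and its Stieltjes measure is the missing summand. -/
lemma measure_le_of_Ioc_le {α β : Measure ℝ} [IsFiniteMeasure α] [IsFiniteMeasure β]
    (h : ∀ s t, s ≤ t → α (Ioc s t) ≤ β (Ioc s t)) : α ≤ β := by
  have hIoc : ∀ (m : Measure ℝ) [IsFiniteMeasure m] (s t : ℝ), s ≤ t →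
      m.real (Iic t) = m.real (Iic s) + m.real (Ioc s t) := by
    intro m _ s t hst
    rw [← Iic_union_Ioc_eq_Iic hst, measureReal_union (Iic_disjoint_Ioc le_rfl) measurableSet_Ioc]
  set F : ℝ → ℝ := fun x => β.real (Iic x) - α.real (Iic x) with hF
  have hincr : ∀ s t, s ≤ t → F t - F s = β.real (Ioc s t) - α.real (Ioc s t) := by
    intro s t hst
    simp only [hF, hIoc α s t hst, hIoc β s t hst]
    ring
  have hle : ∀ s t, s ≤ t → α.real (Ioc s t) ≤ β.real (Ioc s t) := fun s t hst =>
    ENNReal.toReal_mono (measure_ne_top _ _) (h s t hst)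
  have hmono : Monotone F := fun s t hst => by linarith [hincr s t hst, hle s t hst]
  have hseq : ∀ x, Tendsto (fun j : ℕ => F (x + 1 / ((j : ℝ) + 1))) atTop (𝓝 (F x)) := by
    intro x
    have : ∀ (m : Measure ℝ) [IsFiniteMeasure m],
        Tendsto (fun j : ℕ => m.real (Iic (x + 1 / ((j : ℝ) + 1)))) atTop (𝓝 (m.real (Iic x))) :=
      fun m _ => (ENNReal.tendsto_toReal (measure_ne_top _ _)).comp
        (tendsto_measure_Iic_add_one_div (fun _ => measure_ne_top _ _) x)
    exact (this β).sub (this α)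
  let G : StieltjesFunction ℝ :=
    { toFun := F
      mono' := hmono
      right_continuous' := by
        intro x
        refine tendsto_order.2 ⟨fun a ha => ?_, fun a ha => ?_⟩
        · filter_upwards [self_mem_nhdsWithin] with y hy using ha.trans_le (hmono hy)
        · obtain ⟨j, hj⟩ := ((hseq x).eventually_lt_const ha).exists
          have hpos : (0 : ℝ) < 1 / ((j : ℝ) + 1) := Nat.one_div_pos_of_nat
          filter_upwards [Ico_mem_nhdsGE (show x < x + 1 / ((j : ℝ) + 1) by linarith)] with y hy
          exact (hmono hy.2.le).trans_lt hj }
  have hsum : α + G.measure = β := by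
    refine (Measure.ext_of_Ioc β _ fun s t hst => Eq.symm ?_).symm
    rw [Measure.add_apply, G.measure_Ioc, ← ofReal_measureReal (measure_ne_top α _),
      ← ofReal_measureReal (measure_ne_top β _)]
    change _ + ENNReal.ofReal (F t - F s) = _
    rw [hincr s t hst.le, ← ENNReal.ofReal_add measureReal_nonneg
      (sub_nonneg.2 (hle s t hst.le))]
    congr 1; ring
  rw [← hsum]
  exact Measure.le_add_right le_rfl

/-- A signed density whose integrals over the preimages of half-open intervals are nonnegative has
nonnegative integrals over the preimages of all Borel sets. -/
lemma setIntegral_preimage_nonneg {Ω : Type*} [MeasurableSpace Ω] {P : Measure Ω}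
    {X : Ω → ℝ} (hX : Measurable X) {G : Ω → ℝ} (hG : Integrable G P)
    (h : ∀ s t, s ≤ t → 0 ≤ ∫ ω in X ⁻¹' Ioc s t, G ω ∂P) {B : Set ℝ} (hB : MeasurableSet B) :
    0 ≤ ∫ ω in X ⁻¹' B, G ω ∂P := by
  let α := (P.withDensity fun ω => ENNReal.ofReal (-G ω)).map X
  let β := (P.withDensity fun ω => ENNReal.ofReal (G ω)).map X
  have hα : ∀ C, MeasurableSet C → α C = ∫⁻ ω in X ⁻¹' C, ENNReal.ofReal (-G ω) ∂P :=
    fun C hC => by rw [Measure.map_apply hX hC, withDensity_apply _ (hX hC)]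
  have hβ : ∀ C, MeasurableSet C → β C = ∫⁻ ω in X ⁻¹' C, ENNReal.ofReal (G ω) ∂P :=
    fun C hC => by rw [Measure.map_apply hX hC, withDensity_apply _ (hX hC)]
  have : IsFiniteMeasure α := by
    have := isFiniteMeasure_withDensity_ofReal hG.neg.2
    exact Measure.isFiniteMeasure_map _ _
  have : IsFiniteMeasure β := by
    have := isFiniteMeasure_withDensity_ofReal hG.2
    exact Measure.isFiniteMeasure_map _ _
  have hint : ∀ C, MeasurableSet C →
      ∫ ω in X ⁻¹' C, G ω ∂P = (β C).toReal - (α C).toReal := fun C hC => by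
    rw [integral_eq_lintegral_pos_part_sub_lintegral_neg_part hG.restrict, hα C hC, hβ C hC]
  have hle : α ≤ β := measure_le_of_Ioc_le fun s t hst => by
    have := h s t hst
    rw [hint _ measurableSet_Ioc] at this
    exact (ENNReal.toReal_le_toReal (measure_ne_top _ _) (measure_ne_top _ _)).1 (by linarith)
  rw [hint B hB, sub_nonneg]
  exact ENNReal.toReal_mono (measure_ne_top _ _) (hle B)

/-! ### Measures on the plane with given partial second marginals -/

lemma fst_restrict_snd_preimage_apply (P : Measure (ℝ × ℝ)) {A B : Set ℝ} (hB : MeasurableSet B) :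
    (P.restrict (Prod.snd ⁻¹' A)).fst B = P (B ×ˢ A) := by
  rw [Measure.fst_apply hB, Measure.restrict_apply (measurable_fst hB), Set.prod_eq]

/-- A finite measure on the plane is determined by its values on the sets `(-∞, x] × A`. -/
lemma ext_of_Iic_prod {P Q : Measure (ℝ × ℝ)} [IsFiniteMeasure P] [IsFiniteMeasure Q]
    (h : ∀ x A, MeasurableSet A → P (Iic x ×ˢ A) = Q (Iic x ×ˢ A)) : P = Q := by
  refine Measure.ext_prod fun {s t} hs ht => ?_
  rw [← fst_restrict_snd_preimage_apply P hs, ← fst_restrict_snd_preimage_apply Q hs]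
  congr 1
  refine Measure.ext_of_Iic _ _ fun x => ?_
  rw [fst_restrict_snd_preimage_apply P measurableSet_Iic,
    fst_restrict_snd_preimage_apply Q measurableSet_Iic, h x t ht]

section Disintegration

variable {m ν : Measure ℝ} [IsFiniteMeasure m] [IsFiniteMeasure ν] {R : ℝ → Measure ℝ}

/-- For a growing family of measures `R x ≤ ν` whose masses are the distribution function of a
measure `m` with the mass of `ν`, the densities `dR q / dν` at rational `q` are almost everywhere a
distribution function. -/
lemma ae_isRatStieltjesPoint_rnDeriv (hmono : Monotone R) (hle : ∀ x, R x ≤ ν)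
    (hR : ∀ x, R x univ = m (Iic x)) (hν : ν univ = m univ) :
    ∀ᵐ y ∂ν, ProbabilityTheory.IsRatStieltjesPoint
      (fun y (q : ℚ) => ((R q).rnDeriv ν y).toReal) y := by
  have hfin : ∀ x, IsFiniteMeasure (R x) := fun x => isFiniteMeasure_of_le ν (hle x)
  have hd : ∀ (x : ℝ) (A : Set ℝ), ∫⁻ y in A, (R x).rnDeriv ν y ∂ν = R x A := fun x A =>
    Measure.setLIntegral_rnDeriv (Measure.absolutelyContinuous_of_le (hle x)) A
  have hd' : ∀ x : ℝ, ∫⁻ y, (R x).rnDeriv ν y ∂ν = m (Iic x) := fun x => by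
    rw [← setLIntegral_univ, hd, hR]
  have hm : ∀ x, Measurable ((R x).rnDeriv ν) := fun x => Measure.measurable_rnDeriv _ _
  have h1 : ∀ᵐ y ∂ν, ∀ q r : ℚ, q ≤ r → (R q).rnDeriv ν y ≤ (R r).rnDeriv ν y := by
    simp_rw [ae_all_iff]
    intro q r hqr
    refine ae_le_of_forall_setLIntegral_le_of_sigmaFinite (hm q) fun A _ _ => ?_
    rw [hd, hd]
    exact hmono (mod_cast hqr) A
  have h2 : ∀ᵐ y ∂ν, ∀ q : ℚ, (R q).rnDeriv ν y ≤ 1 := by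
    rw [ae_all_iff]
    intro q
    refine ae_le_of_forall_setLIntegral_le_of_sigmaFinite (hm q) fun A _ _ => ?_
    rw [hd, setLIntegral_one]
    exact hle q A
  have htop : ∀ᵐ y ∂ν, Tendsto (fun n : ℕ => (R ((n : ℚ) : ℝ)).rnDeriv ν y) atTop (𝓝 1) := by
    refine tendsto_of_lintegral_tendsto_of_monotone (F := fun _ => 1) aemeasurable_const ?_ ?_ ?_ ?_
    · simp_rw [hd', lintegral_one, hν]
      simp only [Rat.cast_natCast]
      exact (tendsto_measure_Iic_atTop m).comp tendsto_natCast_atTop_atTop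
    · filter_upwards [h1] with y hy i j hij using hy _ _ (mod_cast hij)
    · filter_upwards [h2] with y hy i using hy _
    · simp
  have hbot : ∀ᵐ y ∂ν, Tendsto (fun n : ℕ => (R ((-n : ℚ) : ℝ)).rnDeriv ν y) atTop (𝓝 0) := by
    refine tendsto_of_lintegral_tendsto_of_antitone (F := fun _ => 0) (fun n => (hm _).aemeasurable)
      ?_ ?_ ?_ ?_
    · simp_rw [hd', lintegral_zero]
      simp only [Rat.cast_neg, Rat.cast_natCast]
      have hInter : (⋂ n : ℕ, Iic (-(n : ℝ))) = ∅ := by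
        refine eq_empty_of_forall_notMem fun x hx => ?_
        obtain ⟨n, hn⟩ := exists_nat_gt (-x)
        have := mem_iInter.1 hx n
        rw [mem_Iic] at this
        linarith
      have := tendsto_measure_iInter_atTop (μ := m) (s := fun n : ℕ => Iic (-(n : ℝ)))
        (fun _ => measurableSet_Iic.nullMeasurableSet)
        (fun i j hij => Iic_subset_Iic.2 (neg_le_neg (mod_cast hij))) ⟨0, measure_ne_top _ _⟩
      rwa [hInter, measure_empty] at this
    · filter_upwards [h1] with y hy i j hij
      exact hy _ _ (neg_le_neg (mod_cast hij))
    · exact ae_of_all _ fun y i => zero_le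
    · rw [hd']; exact measure_ne_top _ _
  have hright : ∀ᵐ y ∂ν, ∀ q : ℚ, Tendsto
      (fun n : ℕ => (R ((q + 1 / ((n : ℚ) + 1) : ℚ) : ℝ)).rnDeriv ν y) atTop
      (𝓝 ((R q).rnDeriv ν y)) := by
    rw [ae_all_iff]
    intro q
    refine tendsto_of_lintegral_tendsto_of_antitone (fun n => (hm _).aemeasurable) ?_ ?_ ?_ ?_
    · simp_rw [hd']
      push_cast
      exact tendsto_measure_Iic_add_one_div (fun _ => measure_ne_top _ _) q
    · filter_upwards [h1] with y hy i j hij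
      refine hy _ _ ?_
      gcongr
    · filter_upwards [h1] with y hy i
      exact hy _ _ (le_add_of_nonneg_right (by positivity))
    · rw [hd']; exact measure_ne_top _ _
  filter_upwards [h1, h2, htop, hbot, hright] with y h1 h2 htop hbot hright
  have hne : ∀ q : ℚ, (R q).rnDeriv ν y ≠ ∞ := fun q => ne_top_of_le_ne_top ENNReal.one_ne_top (h2 q)
  have hmon : Monotone fun q : ℚ => ((R q).rnDeriv ν y).toReal := fun q r hqr =>
    ENNReal.toReal_mono (hne r) (h1 q r hqr)
  refine ⟨hmon, ?_, ?_, fun q => ?_⟩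
  · rw [tendsto_iff_tendsto_subseq_of_monotone hmon (tendsto_natCast_atTop_atTop (R := ℚ))]
    have := (ENNReal.tendsto_toReal ENNReal.one_ne_top).comp htop
    rwa [ENNReal.toReal_one] at this
  · have hlim := (ENNReal.tendsto_toReal ENNReal.zero_ne_top).comp hbot
    rw [ENNReal.toReal_zero] at hlim
    refine tendsto_order.2 ⟨fun a ha => Eventually.of_forall fun q =>
      ha.trans_le ENNReal.toReal_nonneg, fun a ha => ?_⟩
    obtain ⟨n, hn⟩ := (hlim.eventually_lt_const ha).exists
    filter_upwards [eventually_le_atBot (-n : ℚ)] with q hq using (hmon hq).trans_lt hn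
  · have hbdd : BddBelow (range fun r : Ioi q => ((R ((r : ℚ) : ℝ)).rnDeriv ν y).toReal) :=
      ⟨0, by rintro _ ⟨r, rfl⟩; exact ENNReal.toReal_nonneg⟩
    refine le_antisymm ?_ ?_
    · refine ge_of_tendsto' ((ENNReal.tendsto_toReal (hne q)).comp (hright q)) fun n => ?_
      exact ciInf_le hbdd ⟨q + 1 / ((n : ℚ) + 1), lt_add_of_pos_right q (by positivity)⟩
    · have : Nonempty (Ioi q) := ⟨⟨q + 1, lt_add_one q⟩⟩
      exact le_ciInf fun r => hmon (le_of_lt r.2)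

/-- A growing family of measures `R x ≤ ν` with masses `m (-∞, x]` is of the form
`R x = P ((-∞, x] × ·)`. The measure `P` has the second marginal `ν`, and its conditional
distribution functions are the densities `dR x / dν`. -/
lemma exists_measure_Iic_prod (hmono : Monotone R) (hle : ∀ x, R x ≤ ν)
    (hR : ∀ x, R x univ = m (Iic x)) (hν : ν univ = m univ) :
    ∃ P : Measure (ℝ × ℝ), IsFiniteMeasure P ∧
      ∀ x A, MeasurableSet A → P (Iic x ×ˢ A) = R x A := by
  have hfin : ∀ x, IsFiniteMeasure (R x) := fun x => isFiniteMeasure_of_le ν (hle x)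
  let f : ℝ → ℚ → ℝ := fun y q => ((R q).rnDeriv ν y).toReal
  have hf : Measurable f := measurable_pi_iff.2 fun q =>
    (Measure.measurable_rnDeriv (R q) ν).ennreal_toReal
  let κ : ProbabilityTheory.Kernel ℝ ℝ :=
    ⟨fun y => (ProbabilityTheory.stieltjesOfMeasurableRat f hf y).measure,
      ProbabilityTheory.measurable_measure_stieltjesOfMeasurableRat hf⟩
  have hκ : ProbabilityTheory.IsMarkovKernel κ :=
    ⟨fun y => ProbabilityTheory.instIsProbabilityMeasure_stieltjesOfMeasurableRat hf y⟩
  let P : Measure (ℝ × ℝ) := (ν.compProd κ).map Prod.swap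
  have hPfin : IsFiniteMeasure P := Measure.isFiniteMeasure_map _ _
  have hP : ∀ B A : Set ℝ, MeasurableSet B → MeasurableSet A →
      P (B ×ˢ A) = ∫⁻ y in A, κ y B ∂ν := fun B A hB hA => by
    rw [Measure.map_apply measurable_swap (hB.prod hA), preimage_swap_prod,
      Measure.compProd_apply_prod hA hB]
  have hrat : ∀ (q : ℚ) (A : Set ℝ), MeasurableSet A → P (Iic (q : ℝ) ×ˢ A) = R q A := by
    intro q A hA
    rw [hP _ _ measurableSet_Iic hA,
      ← Measure.setLIntegral_rnDeriv (Measure.absolutelyContinuous_of_le (hle q)) A]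
    refine lintegral_congr_ae (ae_restrict_of_ae ?_)
    filter_upwards [ae_isRatStieltjesPoint_rnDeriv hmono hle hR hν,
      Measure.rnDeriv_ne_top (R q) ν] with y hy hy'
    change (ProbabilityTheory.stieltjesOfMeasurableRat f hf y).measure (Iic (q : ℝ)) = _
    rw [ProbabilityTheory.measure_stieltjesOfMeasurableRat_Iic,
      ProbabilityTheory.stieltjesOfMeasurableRat_eq,
      ProbabilityTheory.toRatCDF_of_isRatStieltjesPoint hy]
    exact ENNReal.ofReal_toReal hy'
  -- at real `x` both sides are compared with rational points to the right of `x`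
  have hge : ∀ x A, MeasurableSet A → R x A ≤ P (Iic x ×ˢ A) := by
    intro x A hA
    rw [← fst_restrict_snd_preimage_apply P measurableSet_Iic]
    refine ge_of_tendsto' (tendsto_measure_Iic_add_one_div (fun _ => measure_ne_top _ _) x)
      fun j => ?_
    have hpos : (0 : ℝ) < 1 / ((j : ℝ) + 1) := Nat.one_div_pos_of_nat
    obtain ⟨q, hq1, hq2⟩ := exists_rat_btwn (show x < x + 1 / ((j : ℝ) + 1) by linarith)
    rw [fst_restrict_snd_preimage_apply P measurableSet_Iic]
    exact (hmono hq1.le A).trans ((hrat q A hA).symm.trans_le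
      (measure_mono (prod_mono (Iic_subset_Iic.2 hq2.le) subset_rfl)))
  have htot : ∀ x, P (Iic x ×ˢ univ) ≤ m (Iic x) := by
    intro x
    refine ge_of_tendsto' (tendsto_measure_Iic_add_one_div (fun _ => measure_ne_top _ _) x)
      fun j => ?_
    have hpos : (0 : ℝ) < 1 / ((j : ℝ) + 1) := Nat.one_div_pos_of_nat
    obtain ⟨q, hq1, hq2⟩ := exists_rat_btwn (show x < x + 1 / ((j : ℝ) + 1) by linarith)
    calc P (Iic x ×ˢ univ) ≤ P (Iic (q : ℝ) ×ˢ univ) :=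
          measure_mono (prod_mono (Iic_subset_Iic.2 hq1.le) subset_rfl)
      _ = m (Iic (q : ℝ)) := by rw [hrat q _ .univ, hR]
      _ ≤ _ := measure_mono (Iic_subset_Iic.2 hq2.le)
  refine ⟨P, hPfin, fun x A hA => le_antisymm ?_ (hge x A hA)⟩
  have hsplit : P (Iic x ×ˢ A) + P (Iic x ×ˢ Aᶜ) = P (Iic x ×ˢ univ) := by
    rw [← measure_union (disjoint_prod.2 (Or.inr disjoint_compl_right))
      (measurableSet_Iic.prod hA.compl), ← prod_union, union_compl_self]
  have hsum : P (Iic x ×ˢ A) + R x Aᶜ ≤ R x A + R x Aᶜ := by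
    rw [measure_add_measure_compl hA, hR]
    exact (add_le_add le_rfl (hge x _ hA.compl)).trans (hsplit.trans_le (htot x))
  exact (ENNReal.add_le_add_iff_right (measure_ne_top _ _)).1 hsum

end Disintegration

/-! ### Transports to the shadows -/

/-- `P` has first marginal `μ` and, for every `x`, sends the restriction of `μ` to `{e ≤ x}` to its
shadow in `ν`. The increasing and the decreasing transport are the cases where `e` is the identity
and the negation. -/
structure IsTransportAlong (e : ℝ ≃ᵐ ℝ) (μ ν : Measure ℝ) (P : Measure (ℝ × ℝ)) : Prop where
  fst_eq : P.fst = μ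
  apply_prod : ∀ x : ℝ, ∀ A : Set ℝ, MeasurableSet A →
    P ((e ⁻¹' Iic x) ×ˢ A) = shadow (μ.restrict (e ⁻¹' Iic x)) ν A

section TransportAlong

variable {μ ν : Measure ℝ} (e : ℝ ≃ᵐ ℝ)

lemma IsTransportAlong.isFiniteMeasure {e : ℝ ≃ᵐ ℝ} {P : Measure (ℝ × ℝ)} (hP : IsTransportAlong e μ ν P)
    [IsFiniteMeasure μ] : IsFiniteMeasure P := by
  constructor
  rw [← Measure.fst_univ, hP.fst_eq]
  exact measure_lt_top μ univ

/-- Along the growing sets `{e ≤ s} ⊆ {e ≤ t}` the shadow grows, by a measure that dominates the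
part of `μ` in between. -/
lemma exists_isShadow_restrict (h : ConvexDecreasingLE μ ν) {s t : ℝ} (hst : s ≤ t) :
    ∃ σ τ, IsShadow (μ.restrict (e ⁻¹' Iic s)) ν σ ∧
      IsShadow (μ.restrict (e ⁻¹' Iic t)) ν (σ + τ) ∧
      ConvexDecreasingLE (μ.restrict (e ⁻¹' Ioc s t)) τ := by
  have h1 : μ.restrict (e ⁻¹' Iic s) + μ.restrict (e ⁻¹' Ioc s t) = μ.restrict (e ⁻¹' Iic t) := by
    rw [← Iic_union_Ioc_eq_Iic hst, preimage_union, Measure.restrict_union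
      ((Iic_disjoint_Ioc le_rfl).preimage e) (e.measurable measurableSet_Ioc)]
  have h2 : μ.restrict (e ⁻¹' Iic t) + μ.restrict (e ⁻¹' Ioi t) = μ := by
    rw [← compl_Iic, preimage_compl, Measure.restrict_add_restrict_compl
      (e.measurable measurableSet_Iic)]
  rw [← h1]
  refine exists_isShadow_add (μ₃ := μ.restrict (e ⁻¹' Ioi t)) ?_
  rwa [h1, h2]

lemma isShadow_shadow_restrict (h : ConvexDecreasingLE μ ν) (x : ℝ) :
    IsShadow (μ.restrict (e ⁻¹' Iic x)) ν (shadow (μ.restrict (e ⁻¹' Iic x)) ν) := by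
  obtain ⟨σ, -, hσ, -, -⟩ := exists_isShadow_restrict e h (le_refl x)
  rwa [hσ.shadow_eq]

lemma existsUnique_isShadow_restrict (h : ConvexDecreasingLE μ ν) (x : ℝ) :
    ∃! σ, IsShadow (μ.restrict (e ⁻¹' Iic x)) ν σ :=
  ⟨_, isShadow_shadow_restrict e h x, fun _ hσ => hσ.eq (isShadow_shadow_restrict e h x)⟩

/-- The shadows of the growing parts of `μ` form the distribution function of a measure `Q` whose
first coordinate is the value of `e`; undoing `e` in that coordinate gives the transport. -/
lemma existsUnique_isTransportAlong (h : ConvexDecreasingLE μ ν) :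
    ∃! P, IsTransportAlong e μ ν P := by
  have := h.left.isFinite
  have := h.right.isFinite
  have hme : IsFiniteMeasure (μ.map e) := Measure.isFiniteMeasure_map _ _
  have hmass : ∀ x, shadow (μ.restrict (e ⁻¹' Iic x)) ν univ = μ.map e (Iic x) := fun x => by
    have hσ := isShadow_shadow_restrict e h x
    have := hσ.mem.1.isFinite
    have hm := hσ.mem.2.1.measureReal_univ_eq
    rw [measureReal_eq_measureReal_iff, Measure.restrict_apply_univ] at hm
    rw [← hm, e.map_apply]
  obtain ⟨Q, hQfin, hQ⟩ := exists_measure_Iic_prod (m := μ.map e) (ν := ν)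
    (R := fun x => shadow (μ.restrict (e ⁻¹' Iic x)) ν) (fun s t hst => by
      obtain ⟨σ, τ, hσ, hτ, -⟩ := exists_isShadow_restrict e h hst
      simp only [hσ.shadow_eq, hτ.shadow_eq]
      exact Measure.le_add_right le_rfl)
    (fun x => (isShadow_shadow_restrict e h x).mem.2.2) hmass (by
      have hm := h.measureReal_univ_eq
      rw [measureReal_eq_measureReal_iff] at hm
      rw [← hm, e.map_apply, preimage_univ])
  have hmeas : Measurable (Prod.map e.symm id : ℝ × ℝ → ℝ × ℝ) :=
    e.symm.measurable.prodMap measurable_id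
  have happly : ∀ x A, MeasurableSet A → Q.map (Prod.map e.symm id) ((e ⁻¹' Iic x) ×ˢ A) =
      shadow (μ.restrict (e ⁻¹' Iic x)) ν A := fun x A hA => by
    rw [Measure.map_apply hmeas ((e.measurable measurableSet_Iic).prod hA), ← hQ x A hA]
    congr 1
    ext p
    simp
  have hfst : ∀ (P : Measure (ℝ × ℝ)) (x : ℝ),
      P.fst.map e (Iic x) = P ((e ⁻¹' Iic x) ×ˢ univ) := fun P x => by
    rw [e.map_apply, Measure.fst_apply (e.measurable measurableSet_Iic), prod_univ]
  have hPfin : IsFiniteMeasure (Q.map (Prod.map e.symm id)) := Measure.isFiniteMeasure_map _ _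
  refine ⟨Q.map (Prod.map e.symm id), ⟨?_, happly⟩, fun P hP => ?_⟩
  · have : (Q.map (Prod.map e.symm id)).fst.map e = μ.map e := by
      have : IsFiniteMeasure ((Q.map (Prod.map e.symm id)).fst.map e) :=
        Measure.isFiniteMeasure_map _ _
      refine Measure.ext_of_Iic _ _ fun x => ?_
      rw [hfst, happly x _ .univ, hmass]
    exact e.map_measurableEquiv_injective this
  · have hPf := hP.isFiniteMeasure
    have hmeas' : Measurable (Prod.map e id : ℝ × ℝ → ℝ × ℝ) := e.measurable.prodMap measurable_id
    have hfin' : IsFiniteMeasure (P.map (Prod.map e id)) := Measure.isFiniteMeasure_map _ _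
    have key : P.map (Prod.map e id) = Q := ext_of_Iic_prod fun x A hA => by
      rw [Measure.map_apply hmeas' (measurableSet_Iic.prod hA), hQ x A hA, ← hP.apply_prod x A hA]
      rfl
    rw [← key, Measure.map_map hmeas hmeas']
    have : (Prod.map e.symm id ∘ Prod.map e id : ℝ × ℝ → ℝ × ℝ) = id := by
      ext p <;> simp
    rw [this, Measure.map_id]

variable {e}

/-- The second marginal is the limit of the shadows, hence below `ν`, and it has the mass of `ν`. -/
lemma IsTransportAlong.snd_eq {P : Measure (ℝ × ℝ)} (hP : IsTransportAlong e μ ν P)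
    (h : ConvexDecreasingLE μ ν) : P.snd = ν := by
  have := h.left.isFinite
  have := h.right.isFinite
  have := hP.isFiniteMeasure
  have hle : P.snd ≤ ν := by
    refine Measure.le_iff.2 fun A hA => ?_
    have hU : (⋃ n : ℕ, (e ⁻¹' Iic (n : ℝ)) ×ˢ A) = Prod.snd ⁻¹' A := by
      ext p
      simp only [mem_iUnion, mem_prod, mem_preimage, mem_Iic]
      exact ⟨fun ⟨_, hp⟩ => hp.2, fun hp => ⟨_, (exists_nat_ge (e p.1)).choose_spec, hp⟩⟩
    rw [Measure.snd_apply hA, ← hU]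
    refine le_of_tendsto' (tendsto_measure_iUnion_atTop fun i j hij => ?_) fun n => ?_
    · exact prod_mono (preimage_mono (Iic_subset_Iic.2 (mod_cast hij))) subset_rfl
    · rw [Function.comp_apply, hP.apply_prod _ _ hA]
      exact (isShadow_shadow_restrict e h n).mem.2.2 A
  refine Measure.eq_of_le_of_measure_univ_eq hle ?_
  have hm := h.measureReal_univ_eq
  rw [measureReal_eq_measureReal_iff] at hm
  rw [Measure.snd_univ, ← Measure.fst_univ, hP.fst_eq, hm]

/-- The mass starting in `{s < e ≤ t}` is sent to the increment of the shadow between `s` and `t`,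
whose barycentre is at most that of its source; such sets suffice to test the supermartingale
property. -/
lemma IsTransportAlong.mem_supermartingaleCouplings {P : Measure (ℝ × ℝ)}
    (hP : IsTransportAlong e μ ν P) (h : ConvexDecreasingLE μ ν) :
    P ∈ supermartingaleCouplings μ ν := by
  have hsnd := hP.snd_eq h
  have := h.left.isFinite
  have := h.right.isFinite
  have := hP.isFiniteMeasure
  have hint1 : Integrable (fun p : ℝ × ℝ => p.1) P := by
    have := h.left.integrable
    rw [← hP.fst_eq] at this
    exact this.comp_measurable measurable_fst
  have hint2 : Integrable (fun p : ℝ × ℝ => p.2) P := by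
    have := h.right.integrable
    rw [← hsnd] at this
    exact this.comp_measurable measurable_snd
  refine ⟨hP.fst_eq, hsnd, fun A hA => ?_⟩
  have hmeas : Measurable fun p : ℝ × ℝ => e p.1 := e.measurable.comp measurable_fst
  have key := setIntegral_preimage_nonneg hmeas (hint1.sub hint2) (fun s t hst => ?_)
    (e.symm.measurable hA)
  · have hset : (fun p : ℝ × ℝ => e p.1) ⁻¹' (e.symm ⁻¹' A) = Prod.fst ⁻¹' A := by
      ext p; simp
    rw [hset] at key
    simp only [Pi.sub_apply] at key
    rw [integral_sub hint1.integrableOn hint2.integrableOn] at key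
    linarith
  · obtain ⟨σ, τ, hσ, hτ, hcd⟩ := exists_isShadow_restrict e h hst
    have hpre : (fun p : ℝ × ℝ => e p.1) ⁻¹' Ioc s t = Prod.fst ⁻¹' (e ⁻¹' Ioc s t) := rfl
    have hB : MeasurableSet (e ⁻¹' Ioc s t) := e.measurable measurableSet_Ioc
    rw [hpre]
    have h1 : (P.restrict (Prod.fst ⁻¹' (e ⁻¹' Ioc s t))).fst = μ.restrict (e ⁻¹' Ioc s t) := by
      ext A hA
      rw [Measure.fst_apply hA, Measure.restrict_apply (measurable_fst hA),
        Measure.restrict_apply hA, ← hP.fst_eq, Measure.fst_apply (hA.inter hB), preimage_inter]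
    have h2 : (P.restrict (Prod.fst ⁻¹' (e ⁻¹' Ioc s t))).snd = τ := by
      ext A hA
      rw [Measure.snd_apply hA, Measure.restrict_apply (measurable_snd hA), inter_comm,
        ← Set.prod_eq]
      have hs := hP.apply_prod s A hA
      have ht := hP.apply_prod t A hA
      rw [hσ.shadow_eq] at hs
      rw [hτ.shadow_eq, Measure.add_apply, ← hs, ← Iic_union_Ioc_eq_Iic hst, preimage_union,
        union_prod, measure_union (disjoint_prod.2 (Or.inl ((Iic_disjoint_Ioc le_rfl).preimage e)))
          (hB.prod hA)] at ht
      exact (ENNReal.add_right_inj (measure_ne_top _ _)).1 ht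
    have hle := hcd.integral_id_le
    rw [← h1, ← h2, Measure.fst, Measure.snd,
      integral_map (f := fun x : ℝ => x) measurable_fst.aemeasurable aestronglyMeasurable_id,
      integral_map (f := fun x : ℝ => x) measurable_snd.aemeasurable aestronglyMeasurable_id] at hle
    simp only [Pi.sub_apply]
    rw [integral_sub hint1.integrableOn hint2.integrableOn]
    linarith

end TransportAlong

lemma isIncreasingTransport_iff {μ ν : Measure ℝ} {P : Measure (ℝ × ℝ)} :
    IsIncreasingTransport μ ν P ↔ IsTransportAlong (MeasurableEquiv.refl ℝ) μ ν P :=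
  ⟨fun h => ⟨h.1, h.2⟩, fun h => ⟨h.1, h.2⟩⟩

lemma neg_preimage_Iic (x : ℝ) : MeasurableEquiv.neg ℝ ⁻¹' Iic x = Ici (-x) := by
  ext y; simp

lemma isDecreasingTransport_iff {μ ν : Measure ℝ} {P : Measure (ℝ × ℝ)} :
    IsDecreasingTransport μ ν P ↔ IsTransportAlong (MeasurableEquiv.neg ℝ) μ ν P := by
  refine ⟨fun h => ⟨h.1, fun x A hA => ?_⟩, fun h => ⟨h.1, fun x A hA => ?_⟩⟩
  · rw [neg_preimage_Iic, h.apply_prod _ A hA]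
  · have := h.apply_prod (-x) A hA
    rwa [neg_preimage_Iic, neg_neg] at this

/-- Existence and uniqueness of the Increasing and the Decreasing Supermartingale Transport. The
first two clauses say that all the shadows involved are well defined. -/
theorem mainTheorem1 (μ ν : Measure ℝ) (hμν : ConvexDecreasingLE μ ν) :
    (∀ x : ℝ, ∃! σ : Measure ℝ, IsShadow (μ.restrict (Iic x)) ν σ) ∧
    (∀ x : ℝ, ∃! σ : Measure ℝ, IsShadow (μ.restrict (Ici x)) ν σ) ∧
    (∃! P : Measure (ℝ × ℝ), IsIncreasingTransport μ ν P) ∧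
    (∃! P : Measure (ℝ × ℝ), IsDecreasingTransport μ ν P) ∧
    (∀ P : Measure (ℝ × ℝ), IsIncreasingTransport μ ν P ∨ IsDecreasingTransport μ ν P →
      P ∈ supermartingaleCouplings μ ν) := by
  simp only [isIncreasingTransport_iff, isDecreasingTransport_iff]
  refine ⟨existsUnique_isShadow_restrict (MeasurableEquiv.refl ℝ) hμν, fun x => ?_,
    existsUnique_isTransportAlong _ hμν, existsUnique_isTransportAlong _ hμν, ?_⟩
  · have := existsUnique_isShadow_restrict (MeasurableEquiv.neg ℝ) hμν (-x)
    rwa [neg_preimage_Iic, neg_neg] at this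
  · rintro P (hP | hP) <;> exact hP.mem_supermartingaleCouplings hμν
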